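/- Let $\theta_1,\theta_2>0$ and $\alpha>\frac12$. Let $\Lambda=(\mathbb R/2\pi\mathbb Z)^2$. A density matrix of order $k$ is a function $\gamma:\Lambda^k\times\Lambda^k\to\mathbb C$; its Fourier transform is $$\widehat{\gamma}(\vec\xi_k;\vec\xi'_k)=\int_{\Lambda^k\times\Lambda^k}\gamma(\vec x_k;\vec x'_k)\,e^{-i\sum_{j}x_j\cdot\xi_j+i\sum_{j}x'_j\cdot\xi'_j}\,d\vec x_k\,d\vec x'_k,\qquad \vec\xi_k,\vec\xi'_k\in(\mathbb Z^2)^k .$$ Write $\langle\xi\rangle=\sqrt{1+|\xi|^2}$ and $Q(\xi)=\theta_1^2(\xi^1)^2+\theta_2^2(\xi^2)^2$, and let $\Delta_Q=\theta_1^2\partial_{x^1}^2+\theta_2^2\partial_{x^2}^2$ be the modified Laplacian, with symbol $-Q$. * $S^{(k,\alpha)}$ is the operator with $(S^{(k,\alpha)}\gamma)^{\wedge}(\vec\xi_k;\vec\xi'_k)=\prod_{j=1}^k\langle\xi_j\rangle^\alpha\langle\xi'_j\rangle^\alpha\,\widehat\gamma(\vec\xi_k;\vec\xi'_k)$, defined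 for those $\gamma\in L^2$ for which the right-hand side is the Fourier transform of an $L^2$ function. * $\mathcal U_Q^{(k)}(t)\gamma=e^{it\sum_j\Delta_{Q,x_j}}\,\gamma\,e^{-it\sum_j\Delta_{Q,x'_j}}$, i.e. the Fourier coefficients of $\gamma\in L^2$ are multiplied by $e^{-it(\sum_jQ(\xi_j)-\sum_jQ(\xi'_j))}$. * For $j\in\{1,\dots,k\}$, the collision operator $B_{j,k+1}$ maps a trigonometric polynomial $\gamma$ of order $k+1$ to $$B_{j,k+1}\gamma(\vec x_k;\vec x'_k)=\gamma(\vec x_k,x_j;\vec x'_k,x_j)-\gamma(\vec x_k,x'_j;\vec x'_k,x'_j).$$ For a time-dependent $\gamma$ with $\gamma(t)\in L^2(\Lambda^{k+1}\times\Lambda^{k+1})$, $B_{j,k+1}\gamma$ is the limit in $L^2([0,1]\times\Lambda^k\times\Lambda^k)$, if it exists, of $B_{j,k+1}P_F\gamma(t)$ as $F$ increases through the finite sets of frequencies, where $P_F\gamma(t)$ is the truncation of the Fourier series of $\gamma(t)$ to $F$. Then there exists $C>0$, depending only on $\alpha,\theta_1,\theta_2$, such that for all integers $k\ge1$, all $j\in\{1,\dots,k\}$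 and all $\gamma_0^{(k+1)}\in L^2(\Lambda^{k+1}\times\Lambda^{k+1})$ with $S^{(k+1,\alpha)}\gamma_0^{(k+1)}\in L^2(\Lambda^{k+1}\times\Lambda^{k+1})$: the limit $B_{j,k+1}\,\mathcal U_Q^{(k+1)}(t)\gamma_0^{(k+1)}$ exists, $S^{(k,\alpha)}$ is defined on it for almost every $t\in[0,1]$, and $$\big\|S^{(k,\alpha)}B_{j,k+1}\,\mathcal U_Q^{(k+1)}(t)\,\gamma_0^{(k+1)}\big\|_{L^2([0,1]\times\Lambda^k\times\Lambda^k)}\le C\,\big\|S^{(k+1,\alpha)}\gamma_0^{(k+1)}\big\|_{L^2(\Lambda^{k+1}\times\Lambda^{k+1})}.$$ -/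

import Mathlib

open MeasureTheory Filter
open scoped Topology ENNReal Real

noncomputable section

namespace GPHierarchy

instance fact_two_pi_pos : Fact (0 < 2 * π) := ⟨Real.two_pi_pos⟩

/-- The classical torus `Λ = (ℝ / 2πℤ)²`; its `volume` is Lebesgue measure, of total mass `(2π)²`. -/
abbrev Torus : Type := Fin 2 → AddCircle (2 * π)

instance secondCountable_torus : SecondCountableTopology Torus := inferInstance

/-- The lattice `ℤ²` of frequencies. -/
abbrev Lattice : Type := Fin 2 → ℤ

/-- The space `Λ^k × Λ^k`, with points `(x₁, …, x_k; x'₁, …, x'_k)`. -/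
abbrev Space (k : ℕ) : Type := (Fin k → Torus) × (Fin k → Torus)

instance secondCountable_config (k : ℕ) : SecondCountableTopology (Fin k → Torus) := inferInstance

instance borelSpace_config (k : ℕ) : BorelSpace (Fin k → Torus) := inferInstance

instance borelSpace_space (k : ℕ) : BorelSpace (Space k) := Prod.borelSpace

/-- The frequencies `(ξ₁, …, ξ_k; ξ'₁, …, ξ'_k)` dual to `Λ^k × Λ^k`. -/
abbrev Freq (k : ℕ) : Type := (Fin k → Lattice) × (Fin k → Lattice)

/-- A density matrix of order `k` on `Λ`. -/
abbrev DensityMatrix (k : ℕ) : Type := Space k → ℂ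

/-- The character `exp (i ∑ x_j · ξ_j - i ∑ x'_j · ξ'_j)` of `Λ^k × Λ^k`
(`fourier n x = exp (i n x)` on `ℝ / 2πℤ`). -/
def character (k : ℕ) (ζ : Freq k) : C(Space k, ℂ) where
  toFun p := (∏ j, ∏ i, fourier (ζ.1 j i) (p.1 j i)) * ∏ j, ∏ i, fourier (-(ζ.2 j i)) (p.2 j i)
  continuous_toFun := by fun_prop

/-- The (unnormalized) Fourier transform
`γ̂(ξ; ξ') = ∫ γ(x; x') exp (-i ∑ x_j · ξ_j + i ∑ x'_j · ξ'_j) dx dx'`. -/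
def fourierTransform {k : ℕ} (γ : DensityMatrix k) (ζ : Freq k) : ℂ :=
  ∫ p, γ p * (starRingEnd ℂ) (character k ζ p)

/-- The constant `(2π)^{-4k}` of Fourier inversion on `Λ^k × Λ^k`, which has dimension `4k`. -/
def inversionConst (k : ℕ) : ℂ := (((2 * π) ^ (4 * k) : ℝ) : ℂ)⁻¹

/-- The truncation of the Fourier series of `γ` to a finite set `F` of frequencies; it is a
trigonometric polynomial, defined at every point. -/
def partialSum {k : ℕ} (F : Finset (Freq k)) (γ : DensityMatrix k) : DensityMatrix k :=
  fun p => inversionConst k * ∑ ζ ∈ F, fourierTransform γ ζ * character k ζ p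

/-- The Japanese bracket `⟨ξ⟩ = √(1 + |ξ|²)`, with the Euclidean norm. -/
def japaneseBracket (ξ : Lattice) : ℝ := Real.sqrt (1 + ∑ i, (ξ i : ℝ) ^ 2)

/-- The symbol `∏ ⟨ξ_j⟩^α ∏ ⟨ξ'_j⟩^α` of `S^{(k,α)}`. -/
def sobolevWeight {k : ℕ} (α : ℝ) (ζ : Freq k) : ℝ :=
  (∏ j, japaneseBracket (ζ.1 j) ^ α) * ∏ j, japaneseBracket (ζ.2 j) ^ α

/-- `g = S^{(k,α)} γ`, with `γ` and `g` in `L²(Λ^k × Λ^k)`: the graph of the unbounded operator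
`S^{(k,α)}`, given on the Fourier side. It determines `g` almost everywhere. -/
structure IsFracDeriv {k : ℕ} (α : ℝ) (γ g : DensityMatrix k) : Prop where
  memLp : MemLp γ 2 volume
  memLp_deriv : MemLp g 2 volume
  fourier_eq : ∀ ζ, fourierTransform g ζ = (sobolevWeight α ζ : ℂ) * fourierTransform γ ζ

/-- The quadratic form `Q(ξ) = θ₁² (ξ¹)² + θ₂² (ξ²)²`; `-Q` is the symbol of `Δ_Q`. -/
def quadForm (θ : Fin 2 → ℝ) (ξ : Lattice) : ℝ := ∑ i, θ i ^ 2 * (ξ i : ℝ) ^ 2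

/-- The free evolution `U_Q^{(k)}(t) γ = exp (it ∑ Δ_{Q,x_j}) γ exp (-it ∑ Δ_{Q,x'_j})` of
`γ ∈ L²(Λ^k × Λ^k)`, as an `L²`-convergent Fourier series: the Fourier coefficient at `(ξ; ξ')`
is multiplied by `exp (-it (∑ Q(ξ_j) - ∑ Q(ξ'_j)))`. -/
def freeEvolution {k : ℕ} (θ : Fin 2 → ℝ) (t : ℝ) (γ : DensityMatrix k) :
    Lp ℂ 2 (volume : Measure (Space k)) :=
  ∑' ζ : Freq k,
    (inversionConst k *
      (Complex.exp (-(Complex.I * t *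
        ((∑ j, quadForm θ (ζ.1 j) - ∑ j, quadForm θ (ζ.2 j) : ℝ) : ℂ))) *
      fourierTransform γ ζ)) •
    ContinuousMap.toLp (E := ℂ) 2 volume ℂ (character k ζ)

/-- The collision operator `B_{j,k+1}` on kernels with well-defined traces:
`∫ (δ(x_j - y) - δ(x'_j - y)) γ(x, y; x', y) dy = γ(x, x_j; x', x_j) - γ(x, x'_j; x', x'_j)`. -/
def collision {k : ℕ} (j : Fin k) (γ : DensityMatrix (k + 1)) : DensityMatrix k :=
  fun p =>
    γ (Fin.snoc (α := fun _ => Torus) p.1 (p.1 j), Fin.snoc (α := fun _ => Torus) p.2 (p.1 j)) -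
    γ (Fin.snoc (α := fun _ => Torus) p.1 (p.2 j), Fin.snoc (α := fun _ => Torus) p.2 (p.2 j))

/-- The measure `dt dx dx'` on `I × Λ^k × Λ^k`, for a set `I` of times. -/
def slabMeasure (k : ℕ) (I : Set ℝ) : Measure (ℝ × Space k) :=
  (volume.restrict I).prod volume

/-- `H = B_{j,k+1} γ` in `L²(I × Λ^k × Λ^k)`, for a time-dependent density matrix `γ`, each `γ t`
being defined only up to null sets: the collision operator is applied to the Fourier truncations
of `γ t`, and the result converges in `L²` to `H` as the finite set of frequencies exhausts all
frequencies, in whichever order. It determines `H` almost everywhere. -/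
structure IsCollision {k : ℕ} (I : Set ℝ) (j : Fin k) (γ : ℝ → DensityMatrix (k + 1))
    (H : ℝ × Space k → ℂ) : Prop where
  memLp : MemLp H 2 (slabMeasure k I)
  tendsto : Tendsto
    (fun F : Finset (Freq (k + 1)) =>
      eLpNorm (fun q : ℝ × Space k => collision j (partialSum F (γ q.1)) q.2 - H q) 2
        (slabMeasure k I))
    atTop (𝓝 0)

end GPHierarchy

end

/-!
On the Fourier side, each half of the collision operator adds up, for every output frequency `η`,
the modes `ζ` of order `k + 1` whose trace has frequency `η`. Only the `j`-th output frequency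
`ξ = η_j` differs from the corresponding input, and the modes in question are parametrized by two
shifts `u, v ∈ ℤ²`: the three input frequencies that interact are `ξ + u`, `ξ + v` and `ξ + u + v`.
Because `Q` is quadratic, the phase velocity of the mode differs from that of the output by
`-2 (θ₁² u¹ v¹ + θ₂² u² v²)`. If the indicator function of `[0, 1]` is majorized by a Gaussian, two
modes with the same output interact only through a Gaussian kernel `K` of the difference of their
phase velocities (`lintegral_enorm_waveSum_sq_le`), and the Schur test (`sum_sum_le_of_schur`)
reduces the estimate to a bound, uniform in `ξ` and `l`, for

  `∑_{u, v} (⟨ξ⟩ / (⟨ξ + u⟩ ⟨ξ + v⟩ ⟨ξ + u + v⟩)) ^ (2α) K (2 θ₁² u¹ v¹ + 2 θ₂² u² v² + l)`,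

which is `exists_tsum_interactionWeight_le`.

One of the three brackets is at least `⟨ξ⟩ / 3`, so that two of them remain
(`ofReal_interactionWeight_le`). What remains is bounded by sums of products of a factor in
`(u¹, v¹)` and a factor in `(u², v²)`, where one factor is summable and the other one need only have
bounded resonant sums, for then the other coordinate can be frozen (`tsum_tensor_le`). If
`u^i v^i ≠ 0` for both `i`, the exponent `2α > 1` is distributed so that one coordinate carries an
exponent larger than `1` and the other one an arbitrarily small positive exponent `δ`. A resonant
sum with exponent `δ` is bounded by the divisor bound: there are at most `C |m| ^ ε` factorizations
`u v = m`, which is harmless where the product of the two brackets exceeds a fixed power of `|m|`,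
and elsewhere the brackets confine the factors to intervals so short that at most one
factorization is left, up to order (`exists_tsum_factorization_le`). No arithmetic property of
`θ₁ / θ₂` enters. The degenerate pairs, with `u^i v^i = 0` for some `i`, are summed directly.

The uniform bound for finite sets of modes gives unconditional convergence in `L²` of the collision
of the free evolution and of its fractional derivative (`exists_tendsto_eLpNorm_sum`), and the
relation between the Fourier coefficients of the two limits holds for almost every time since it
holds for the partial sums (`ae_fourierTransform_eq_of_tendsto`). Bessel's inequality bounds the
coefficients by the `L²` norm of the fractional derivative of the initial datum.
-/

namespace GPHierarchy

/-! ### Divisor bound and sums over factorizations -/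

/-- The divisor bound `d(n) ≤ C n ^ ε`: in the product over the primes `p ∣ n` of
`(a + 1) / p ^ (a ε)`, every factor with `p ^ ε ≥ 2` is at most `1`, and the finitely many others are
bounded. -/
theorem exists_card_divisors_le_rpow {ε : ℝ} (hε : 0 < ε) :
    ∃ C : ℝ, 0 < C ∧ ∀ n : ℕ, n ≠ 0 → (n.divisors.card : ℝ) ≤ C * (n : ℝ) ^ ε := by
  set M : ℝ := 1 + 1 / (ε * Real.log 2) with hM
  set P : ℕ := ⌈(2 : ℝ) ^ (1 / ε)⌉₊ with hP
  have hl : 0 < Real.log 2 := Real.log_pos (by norm_num)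
  have hM1 : 1 ≤ M := by
    have : 0 ≤ 1 / (ε * Real.log 2) := by positivity
    linarith
  refine ⟨M ^ P, by positivity, fun n hn => ?_⟩
  have key : ∀ p ∈ n.primeFactors, ((n.factorization p + 1 : ℕ) : ℝ) ≤
      (if p < P then M else 1) * ((p : ℝ) ^ n.factorization p) ^ ε := by
    intro p hp
    have hp2 : 2 ≤ p := (Nat.prime_of_mem_primeFactors hp).two_le
    have hp2' : (2 : ℝ) ≤ p := by exact_mod_cast hp2
    set a := n.factorization p
    have e1 : ((p : ℝ) ^ a) ^ ε = ((p : ℝ) ^ ε) ^ a := by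
      rw [← Real.rpow_natCast, ← Real.rpow_natCast, ← Real.rpow_mul (by positivity),
        ← Real.rpow_mul (by positivity), mul_comm]
    rw [e1]
    split_ifs with h
    · have h1 : (1 + ε * Real.log 2) ≤ (p : ℝ) ^ ε := by
        calc (1 + ε * Real.log 2) ≤ Real.exp (ε * Real.log 2) := by
              linarith [Real.add_one_le_exp (ε * Real.log 2)]
          _ = (2 : ℝ) ^ ε := by rw [Real.rpow_def_of_pos (by norm_num), mul_comm]
          _ ≤ (p : ℝ) ^ ε := by gcongr
      have h2 : 1 + a * (ε * Real.log 2) ≤ ((p : ℝ) ^ ε) ^ a := by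
        refine le_trans (one_add_mul_le_pow ?_ a) (by gcongr)
        have : 0 ≤ ε * Real.log 2 := by positivity
        linarith
      calc ((a + 1 : ℕ) : ℝ) = 1 + 1 / (ε * Real.log 2) * (a * (ε * Real.log 2)) := by
            field_simp; push_cast; ring
        _ ≤ M * (1 + a * (ε * Real.log 2)) := by
            have h3 : 0 ≤ 1 / (ε * Real.log 2) := by positivity
            have h4 : 0 ≤ a * (ε * Real.log 2) := by positivity
            rw [hM]; nlinarith
        _ ≤ _ := by gcongr
    · have h1 : (2 : ℝ) ≤ (p : ℝ) ^ ε := by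
        have h3 : (2 : ℝ) ^ (1 / ε) ≤ p := (Nat.le_ceil _).trans (by exact_mod_cast not_lt.mp h)
        calc (2 : ℝ) = ((2 : ℝ) ^ (1 / ε)) ^ ε := by
              rw [← Real.rpow_mul (by norm_num), one_div_mul_cancel hε.ne', Real.rpow_one]
          _ ≤ _ := by gcongr
      rw [one_mul]
      calc ((a + 1 : ℕ) : ℝ) ≤ 2 ^ a := by exact_mod_cast Nat.lt_two_pow_self
        _ ≤ _ := by gcongr
  rw [Nat.card_divisors hn, Nat.cast_prod]
  refine (Finset.prod_le_prod (fun _ _ => by positivity) key).trans ?_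
  rw [Finset.prod_mul_distrib, Real.finsetProd_rpow _ _ (fun _ _ => by positivity)]
  have e : (∏ p ∈ n.primeFactors, (p : ℝ) ^ n.factorization p) = n := by
    conv_rhs => rw [← Nat.prod_factorization_pow_eq_self hn]
    rw [Finsupp.prod, Nat.support_factorization]; push_cast; rfl
  rw [e]
  gcongr
  rw [Finset.prod_ite, Finset.prod_const_one, mul_one, Finset.prod_const]
  refine pow_le_pow_right₀ hM1 ?_
  calc _ ≤ (Finset.range P).card := Finset.card_le_card fun p hp => by
        simpa using (Finset.mem_filter.mp hp).2
    _ = P := Finset.card_range P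

theorem card_divisorsAntidiag_le (m : ℤ) :
    m.divisorsAntidiag.card ≤ 2 * m.natAbs.divisors.card := by
  have : m.divisorsAntidiag.card ≤ (m.natAbs.divisors ×ˢ ({1, -1} : Finset ℤ)).card := by
    refine Finset.card_le_card_of_injOn (fun p => (p.1.natAbs, p.1.sign)) ?_ ?_
    · rintro ⟨u, v⟩ h
      simp only [Finset.mem_coe, Int.mem_divisorsAntidiag] at h
      obtain ⟨h, hm⟩ := h
      have hu : u ≠ 0 := by rintro rfl; simp at h; exact hm h.symm
      simp only [Finset.coe_product, Set.mem_prod, Finset.mem_coe, Nat.mem_divisors]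
      refine ⟨⟨Int.natAbs_dvd_natAbs.mpr ⟨v, h.symm⟩, by simpa using hm⟩, ?_⟩
      rcases lt_or_gt_of_ne hu with h | h
      · simp [Int.sign_eq_neg_one_of_neg h]
      · simp [Int.sign_eq_one_of_pos h]
    · rintro ⟨u, v⟩ h ⟨u', v'⟩ h' e
      simp only [Finset.mem_coe, Int.mem_divisorsAntidiag] at h h'
      simp only [Prod.mk.injEq] at e
      have hu : u ≠ 0 := by rintro rfl; simp at h; exact h.2 h.1.symm
      have e1 : u = u' := by
        rw [← Int.sign_mul_natAbs u, ← Int.sign_mul_natAbs u', e.1, e.2]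
      subst e1
      rw [Prod.mk.injEq]
      exact ⟨rfl, mul_left_cancel₀ hu (h.1.trans h'.1.symm)⟩
  rw [Finset.card_product, Finset.card_pair (by norm_num)] at this
  omega

/-- The factorizations of `m ≠ 0`, weighted by a negative power of a function `N ≥ 1`, have bounded
total weight if the region where `N` is small compared with `|m|` contains at most one factorization
up to order: elsewhere the weight beats the number of divisors of `m`. -/
theorem exists_tsum_factorization_le {δ : ℝ} (hδ : 0 < δ) :
    ∃ C : ℝ≥0∞, C ≠ ⊤ ∧ ∀ (m : ℤ), m ≠ 0 → ∀ N : ℤ × ℤ → ℝ, (∀ p, 1 ≤ N p) →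
      (∀ p q : ℤ × ℤ, p.1 * p.2 = m → q.1 * q.2 = m →
        80 * N p ^ 4 < |(m : ℝ)| → 80 * N q ^ 4 < |(m : ℝ)| → q = p ∨ q = p.swap) →
      ∑' p : ℤ × ℤ, (if p.1 * p.2 = m then ENNReal.ofReal (N p ^ (-δ)) else 0) ≤ C := by
  obtain ⟨C, hC, hd⟩ := exists_card_divisors_le_rpow (ε := δ / 4) (by positivity)
  refine ⟨ENNReal.ofReal (2 + 2 * C * 80 ^ (δ / 4)), ENNReal.ofReal_ne_top, ?_⟩
  intro m hm N hN huniq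
  have hsub : ∀ p ∉ m.divisorsAntidiag,
      (if p.1 * p.2 = m then ENNReal.ofReal (N p ^ (-δ)) else 0) = 0 := by
    intro p hp
    rw [if_neg]
    intro h
    exact hp (Int.mem_divisorsAntidiag.mpr ⟨h, hm⟩)
  rw [tsum_eq_sum hsub]
  have hle : ∀ p ∈ m.divisorsAntidiag,
      (if p.1 * p.2 = m then ENNReal.ofReal (N p ^ (-δ)) else 0) ≤ ENNReal.ofReal (N p ^ (-δ)) := by
    intro p _
    split_ifs <;> simp
  refine (Finset.sum_le_sum hle).trans ?_
  rw [← ENNReal.ofReal_sum_of_nonneg (fun p _ => Real.rpow_nonneg (by linarith [hN p]) _)]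
  apply ENNReal.ofReal_le_ofReal
  rw [← Finset.sum_filter_add_sum_filter_not _ (fun p => 80 * N p ^ 4 < |(m : ℝ)|)]
  have hmpos : 0 < |(m : ℝ)| := by simpa using hm
  gcongr
  -- at most two factorizations have small `N`, and each of them contributes at most `1`
  · have hcard : (m.divisorsAntidiag.filter (fun p => 80 * N p ^ 4 < |(m : ℝ)|)).card ≤ 2 := by
      rcases Finset.eq_empty_or_nonempty
        (m.divisorsAntidiag.filter (fun p => 80 * N p ^ 4 < |(m : ℝ)|)) with h | ⟨p, hp⟩
      · simp [h]
      · refine (Finset.card_le_card (t := {p, p.swap}) fun q hq => ?_).trans Finset.card_le_two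
        simp only [Finset.mem_filter, Int.mem_divisorsAntidiag] at hp hq
        simpa using huniq p q hp.1.1 hq.1.1 hp.2 hq.2
    calc _ ≤ ∑ p ∈ m.divisorsAntidiag.filter (fun p => 80 * N p ^ 4 < |(m : ℝ)|), (1 : ℝ) :=
          Finset.sum_le_sum fun p _ =>
            Real.rpow_le_one_of_one_le_of_nonpos (hN p) (by linarith)
      _ ≤ 2 := by simp; exact_mod_cast hcard
  -- all others are so light that their number is compensated
  · have hterm : ∀ p ∈ m.divisorsAntidiag.filter (fun p => ¬ 80 * N p ^ 4 < |(m : ℝ)|),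
        N p ^ (-δ) ≤ 80 ^ (δ / 4) * |(m : ℝ)| ^ (-(δ / 4)) := by
      intro p hp
      have h := not_lt.mp (Finset.mem_filter.mp hp).2
      have hNp := hN p
      have h1 : |(m : ℝ)| ^ (δ / 4) ≤ 80 ^ (δ / 4) * N p ^ δ := by
        calc |(m : ℝ)| ^ (δ / 4) ≤ (80 * N p ^ 4) ^ (δ / 4) := by gcongr
          _ = 80 ^ (δ / 4) * N p ^ δ := by
            rw [Real.mul_rpow (by norm_num) (by positivity), ← Real.rpow_natCast (N p),
              ← Real.rpow_mul (by linarith)]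
            congr 2; push_cast; ring
      rw [Real.rpow_neg (by linarith), Real.rpow_neg hmpos.le]
      rw [← div_eq_mul_inv, inv_eq_one_div, div_le_div_iff₀ (by positivity) (by positivity), one_mul]
      exact h1
    refine (Finset.sum_le_sum hterm).trans ?_
    rw [Finset.sum_const, nsmul_eq_mul]
    have hc : ((m.divisorsAntidiag.filter (fun p => ¬ 80 * N p ^ 4 < |(m : ℝ)|)).card : ℝ) ≤
        2 * (C * |(m : ℝ)| ^ (δ / 4)) := by
      calc _ ≤ (m.divisorsAntidiag.card : ℝ) := by exact_mod_cast Finset.card_filter_le _ _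
        _ ≤ 2 * (m.natAbs.divisors.card : ℝ) := by exact_mod_cast card_divisorsAntidiag_le m
        _ ≤ _ := by
          have := hd m.natAbs (by simpa using hm)
          rw [Nat.cast_natAbs, Int.cast_abs] at this
          gcongr
    calc _ ≤ 2 * (C * |(m : ℝ)| ^ (δ / 4)) * (80 ^ (δ / 4) * |(m : ℝ)| ^ (-(δ / 4))) := by gcongr
      _ = 2 * C * 80 ^ (δ / 4) * (|(m : ℝ)| ^ (δ / 4) * |(m : ℝ)| ^ (-(δ / 4))) := by ring
      _ = _ := by rw [← Real.rpow_add hmpos]; simp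

/-! ### Brackets, rigidity of factorizations, and the Gaussian kernel on `ℤ` -/

/-- The one-dimensional Japanese bracket `√(1 + n²)`. -/
noncomputable def intBracket (n : ℤ) : ℝ := Real.sqrt (1 + (n : ℝ) ^ 2)

theorem one_le_intBracket (n : ℤ) : 1 ≤ intBracket n :=
  Real.one_le_sqrt.mpr (by nlinarith [sq_nonneg (n : ℝ)])

theorem abs_le_intBracket (n : ℤ) : |(n : ℝ)| ≤ intBracket n :=
  Real.abs_le_sqrt (by linarith)

theorem abs_le_mul_intBracket (n m : ℤ) : |(n : ℝ)| ≤ intBracket n * intBracket m :=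
  (abs_le_intBracket n).trans (le_mul_of_one_le_right (by linarith [one_le_intBracket n])
    (one_le_intBracket m))

theorem one_le_intBracket_mul (n m : ℤ) : 1 ≤ intBracket n * intBracket m :=
  one_le_mul_of_one_le_of_one_le (one_le_intBracket n) (one_le_intBracket m)

/-- An integer that is large compared with `M` has at most one factorization, up to order, with
both factors within `M` of a given integer. -/
theorem factorization_unique_of_near_near {x u v u' v' : ℤ} {M : ℝ} (hM : 1 ≤ M)
    (h : u * v = u' * v') (hu : |((x + u : ℤ) : ℝ)| ≤ M) (hv : |((x + v : ℤ) : ℝ)| ≤ M)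
    (hu' : |((x + u' : ℤ) : ℝ)| ≤ M) (hv' : |((x + v' : ℤ) : ℝ)| ≤ M)
    (hbig : 80 * M ^ 4 < |((u * v : ℤ) : ℝ)|) :
    (u' = u ∧ v' = v) ∨ (u' = v ∧ v' = u) := by
  have key : u * ((v' - v) + (u' - u)) = -((u' - u) * ((v - u) + (v' - v))) := by
    linear_combination -h
  push_cast at hu hv hu' hv' hbig
  rw [abs_le] at hu hv hu' hv'
  by_cases h0 : (v' - v) + (u' - u) = 0
  · rw [h0, mul_zero, eq_comm, neg_eq_zero, mul_eq_zero] at key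
    rcases key with h1 | h1
    · left; constructor <;> omega
    · right; constructor <;> omega
  · exfalso
    have h1 : (1 : ℝ) ≤ |(((v' - v) + (u' - u) : ℤ) : ℝ)| := by
      rw [← Int.cast_abs]; exact_mod_cast Int.one_le_abs h0
    have hs : |((u' - u : ℤ) : ℝ)| ≤ 2 * M := by
      rw [abs_le]; push_cast; constructor <;> linarith
    have hw : |(((v - u) + (v' - v) : ℤ) : ℝ)| ≤ 4 * M := by
      rw [abs_le]; push_cast; constructor <;> linarith
    have hU : |(u : ℝ)| ≤ 8 * M ^ 2 := by
      calc |(u : ℝ)| ≤ |(u : ℝ)| * |(((v' - v) + (u' - u) : ℤ) : ℝ)| :=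
            le_mul_of_one_le_right (abs_nonneg _) h1
        _ = |((u' - u : ℤ) : ℝ)| * |(((v - u) + (v' - v) : ℤ) : ℝ)| := by
            rw [← abs_mul, ← abs_mul, ← Int.cast_mul, ← Int.cast_mul, key, Int.cast_neg, abs_neg]
        _ ≤ (2 * M) * (4 * M) := by gcongr
        _ = 8 * M ^ 2 := by ring
    have hV : |(v : ℝ)| ≤ 10 * M ^ 2 := by
      have : |(v : ℝ)| ≤ |(u : ℝ)| + 2 * M := by
        have e : (v : ℝ) = u + (v - u) := by ring
        rw [e]
        refine (abs_add_le _ _).trans ?_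
        gcongr
        rw [abs_le]; constructor <;> linarith
      nlinarith
    have : |(u : ℝ) * v| ≤ (8 * M ^ 2) * (10 * M ^ 2) := by
      rw [abs_mul]; gcongr
    nlinarith

/-- An integer that is large compared with `M` has at most one factorization `u v` with `u` within
`M` of a given integer `-x` and `u + v` within `M` of it too. -/
theorem factorization_unique_of_near_small {x u v u' v' : ℤ} {M : ℝ} (hM : 1 ≤ M)
    (h : u * v = u' * v') (hu : |((x + u : ℤ) : ℝ)| ≤ M) (hv : |((x + u + v : ℤ) : ℝ)| ≤ M)
    (hu' : |((x + u' : ℤ) : ℝ)| ≤ M) (hv' : |((x + u' + v' : ℤ) : ℝ)| ≤ M)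
    (hbig : 80 * M ^ 4 < |((u * v : ℤ) : ℝ)|) : u' = u ∧ v' = v := by
  have key : u * (v - v') = (u' - u) * v' := by linear_combination h
  have hv0 : v ≠ 0 := by
    rintro rfl
    simp at hbig
    have : 0 < M ^ 4 := by positivity
    linarith
  push_cast at hu hv hu' hv' hbig
  rw [abs_le] at hu hv hu' hv'
  by_cases h0 : v - v' = 0
  · have h1 : v' = v := by omega
    subst h1
    exact ⟨(mul_right_cancel₀ hv0 h).symm, rfl⟩
  · exfalso
    have h1 : (1 : ℝ) ≤ |((v - v' : ℤ) : ℝ)| := by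
      rw [← Int.cast_abs]; exact_mod_cast Int.one_le_abs h0
    have hs : |((u' - u : ℤ) : ℝ)| ≤ 2 * M := by
      rw [abs_le]; push_cast; constructor <;> linarith
    have hw : |(v' : ℝ)| ≤ 2 * M := by
      rw [abs_le]; constructor <;> linarith
    have hV : |(v : ℝ)| ≤ 2 * M := by
      rw [abs_le]; constructor <;> linarith
    have hU : |(u : ℝ)| ≤ 4 * M ^ 2 := by
      calc |(u : ℝ)| ≤ |(u : ℝ)| * |((v - v' : ℤ) : ℝ)| :=
            le_mul_of_one_le_right (abs_nonneg _) h1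
        _ = |((u' - u : ℤ) : ℝ)| * |(v' : ℝ)| := by
            rw [← abs_mul, ← abs_mul, ← Int.cast_mul, ← Int.cast_mul, key]
        _ ≤ (2 * M) * (2 * M) := by gcongr
        _ = 4 * M ^ 2 := by ring
    have h3 : |(u : ℝ) * v| ≤ (4 * M ^ 2) * (2 * M) := by
      rw [abs_mul]; gcongr
    have h4 : M ^ 3 ≤ M ^ 4 := pow_le_pow_right₀ hM (by norm_num)
    nlinarith

/-- The weight `⟨n⟩ ^ (-s)` on `ℤ`, with values in `ℝ≥0∞`. -/
noncomputable def intWeight (s : ℝ) (n : ℤ) : ℝ≥0∞ := ENNReal.ofReal (intBracket n ^ (-s))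

theorem intWeight_mul_intWeight (s : ℝ) (n m : ℤ) :
    intWeight s n * intWeight s m = ENNReal.ofReal ((intBracket n * intBracket m) ^ (-s)) := by
  have h1 := one_le_intBracket n
  have h2 := one_le_intBracket m
  rw [intWeight, intWeight, ← ENNReal.ofReal_mul (by positivity),
    Real.mul_rpow (by linarith) (by linarith)]

theorem tsum_intWeight_ne_top {s : ℝ} (hs : 1 < s) : ∑' n, intWeight s n ≠ ⊤ := by
  refine Summable.tsum_ofReal_ne_top ?_
  refine Summable.of_norm_bounded_eventually (g := fun n : ℤ => |(n : ℝ)| ^ (-s))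
    (Real.summable_abs_int_rpow hs) ?_
  rw [Filter.eventually_cofinite]
  refine (Set.finite_singleton (0 : ℤ)).subset fun n hn => ?_
  by_contra h0
  apply hn
  have h1 : 0 < |(n : ℝ)| := by simpa using h0
  have h2 := one_le_intBracket n
  rw [Real.norm_of_nonneg (by positivity)]
  exact Real.rpow_le_rpow_of_nonpos h1 (abs_le_intBracket n) (by linarith)

theorem tsum_intWeight_add_left (s : ℝ) (x : ℤ) :
    ∑' n, intWeight s (x + n) = ∑' n, intWeight s n :=
  (Equiv.addLeft x).tsum_eq (intWeight s)

/-- The kernel `exp (-s² / 4)`, up to a constant the Fourier transform of a Gaussian. -/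
noncomputable def gaussKernel (s : ℝ) : ℝ≥0∞ := ENNReal.ofReal (Real.exp (-(s ^ 2 / 4)))

theorem gaussKernel_le_one (s : ℝ) : gaussKernel s ≤ 1 := by
  rw [gaussKernel, ← ENNReal.ofReal_one]
  exact ENNReal.ofReal_le_ofReal (Real.exp_le_one_iff.mpr (by nlinarith [sq_nonneg s]))

/-- Sums of the Gaussian kernel over arithmetic progressions are bounded, uniformly in the phase
and in the step, as long as the step is bounded below. -/
theorem exists_tsum_gaussKernel_le {κ₀ : ℝ} (h₀ : 0 < κ₀) :
    ∃ C : ℝ≥0∞, C ≠ ⊤ ∧ ∀ κ l : ℝ, κ₀ ≤ |κ| → ∑' n : ℤ, gaussKernel (κ * n + l) ≤ C := by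
  set c : ℝ := κ₀ ^ 2 / 16 with hc
  have hc0 : 0 < c := by positivity
  have hsum : Summable fun n : ℤ => (1 + c * (n : ℝ) ^ 2)⁻¹ := by
    refine Summable.of_norm_bounded_eventually (g := fun n : ℤ => c⁻¹ * (1 / (n : ℝ) ^ 2))
      ((Real.summable_one_div_int_pow.mpr (by norm_num)).mul_left _) ?_
    rw [Filter.eventually_cofinite]
    refine (Set.finite_singleton (0 : ℤ)).subset fun n hn => ?_
    by_contra h0
    apply hn
    have h1 : 0 < (n : ℝ) ^ 2 := by
      have : (n : ℝ) ≠ 0 := by simpa using h0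
      positivity
    rw [Real.norm_of_nonneg (by positivity), one_div, ← mul_inv]
    exact inv_anti₀ (by positivity) (by linarith)
  refine ⟨_, hsum.tsum_ofReal_ne_top, fun κ l hκ => ?_⟩
  have hκ0 : κ ≠ 0 := by rintro rfl; simp at hκ; linarith
  set n₀ : ℤ := round (-l / κ)
  rw [← (Equiv.addRight n₀).tsum_eq]
  refine ENNReal.tsum_le_tsum fun n => ENNReal.ofReal_le_ofReal ?_
  simp only [Equiv.coe_addRight]
  have hr := abs_sub_round (-l / κ)
  have h1 : (n : ℝ) ^ 2 / 4 ≤ (n + n₀ + l / κ) ^ 2 := by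
    by_cases hn : n = 0
    · subst hn; simp; positivity
    have h2 : (1 : ℝ) ≤ |(n : ℝ)| := by rw [← Int.cast_abs]; exact_mod_cast Int.one_le_abs hn
    have h3 : |(n : ℝ)| / 2 ≤ |n + n₀ + l / κ| := by
      have : |(n : ℝ)| ≤ |n + n₀ + l / κ| + |(-l / κ) - n₀| := by
        refine le_trans (le_of_eq ?_) (abs_add_le _ _)
        congr 1; ring
      change |(-l / κ) - n₀| ≤ _ at hr
      linarith
    calc (n : ℝ) ^ 2 / 4 = (|(n : ℝ)| / 2) ^ 2 := by rw [div_pow, sq_abs]; norm_num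
      _ ≤ |n + n₀ + l / κ| ^ 2 := by gcongr
      _ = _ := sq_abs _
  have h4 : c * (n : ℝ) ^ 2 ≤ (κ * ((n + n₀ : ℤ) : ℝ) + l) ^ 2 / 4 := by
    have e : κ * ((n + n₀ : ℤ) : ℝ) + l = κ * (n + n₀ + l / κ) := by
      push_cast; field_simp
    rw [e, mul_pow, hc]
    have h5 : κ₀ ^ 2 ≤ κ ^ 2 := by rw [← sq_abs κ]; gcongr
    nlinarith [sq_nonneg (n : ℝ), sq_nonneg κ₀]
  rw [Real.exp_neg]
  refine inv_anti₀ (by positivity) ?_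
  linarith [Real.add_one_le_exp ((κ * ((n + n₀ : ℤ) : ℝ) + l) ^ 2 / 4)]

/-! ### One-dimensional resonant sums -/

/-- The properties of `N (u, v) = ⟨p⟩ ⟨q⟩`, for `p` and `q` two of `x + u`, `x + v`, `x + u + v`, that
are used: its powers sum like those of `⟨p⟩ ⟨q⟩` over `ℤ × ℤ`, and a large integer `m` has at most one
factorization `u v = m`, up to order, with `N (u, v)` small compared with `|m|`. -/
structure AdmissibleWeight (N : ℤ × ℤ → ℝ) : Prop where
  one_le : ∀ y, 1 ≤ N y
  tsum_rpow : ∀ s : ℝ, ∑' y, ENNReal.ofReal (N y ^ (-s)) = (∑' n, intWeight s n) ^ 2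
  unique : ∀ (m : ℤ) (p q : ℤ × ℤ), p.1 * p.2 = m → q.1 * q.2 = m →
    80 * N p ^ 4 < |(m : ℝ)| → 80 * N q ^ 4 < |(m : ℝ)| → q = p ∨ q = p.swap

theorem tsum_prod_mul (f g : ℤ → ℝ≥0∞) :
    ∑' y : ℤ × ℤ, f y.1 * g y.2 = (∑' n, f n) * ∑' n, g n := by
  rw [ENNReal.tsum_prod (f := fun a b => f a * g b)]
  simp_rw [ENNReal.tsum_mul_left, ENNReal.tsum_mul_right]

theorem admissibleWeight_near_near (x : ℤ) :
    AdmissibleWeight (fun y => intBracket (x + y.1) * intBracket (x + y.2)) where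
  one_le y := one_le_intBracket_mul _ _
  tsum_rpow s := by
    simp_rw [← intWeight_mul_intWeight]
    rw [tsum_prod_mul (fun n => intWeight s (x + n)) (fun n => intWeight s (x + n)),
      tsum_intWeight_add_left, sq]
  unique := by
    rintro m ⟨u, v⟩ ⟨u', v'⟩ h h' hp hq
    set M := max (intBracket (x + u) * intBracket (x + v))
      (intBracket (x + u') * intBracket (x + v')) with hMdef
    have hM : 1 ≤ M := le_max_of_le_left (one_le_intBracket_mul _ _)
    have hl : intBracket (x + u) * intBracket (x + v) ≤ M := le_max_left _ _
    have hr : intBracket (x + u') * intBracket (x + v') ≤ M := le_max_right _ _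
    have := factorization_unique_of_near_near (x := x) hM (h.trans h'.symm)
      ((abs_le_mul_intBracket _ _).trans hl)
      ((abs_le_mul_intBracket _ _).trans (le_of_eq_of_le (mul_comm _ _) hl))
      ((abs_le_mul_intBracket _ _).trans hr)
      ((abs_le_mul_intBracket _ _).trans (le_of_eq_of_le (mul_comm _ _) hr))
      (by simp only at h; rw [h]; rcases max_choice (intBracket (x + u) * intBracket (x + v))
            (intBracket (x + u') * intBracket (x + v')) with e | e <;>
          rw [hMdef, e] <;> assumption)
    simpa [Prod.ext_iff] using this

theorem admissibleWeight_near_sum (x : ℤ) :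
    AdmissibleWeight (fun y => intBracket (x + y.1) * intBracket (x + y.1 + y.2)) where
  one_le y := one_le_intBracket_mul _ _
  tsum_rpow s := by
    simp_rw [← intWeight_mul_intWeight]
    rw [ENNReal.tsum_prod (f := fun a b => intWeight s (x + a) * intWeight s (x + a + b))]
    simp_rw [ENNReal.tsum_mul_left, tsum_intWeight_add_left, ENNReal.tsum_mul_right,
      tsum_intWeight_add_left, sq]
  unique := by
    rintro m ⟨u, v⟩ ⟨u', v'⟩ h h' hp hq
    set M := max (intBracket (x + u) * intBracket (x + u + v))
      (intBracket (x + u') * intBracket (x + u' + v')) with hMdef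
    have hM : 1 ≤ M := le_max_of_le_left (one_le_intBracket_mul _ _)
    have hl : intBracket (x + u) * intBracket (x + u + v) ≤ M := le_max_left _ _
    have hr : intBracket (x + u') * intBracket (x + u' + v') ≤ M := le_max_right _ _
    have := factorization_unique_of_near_small (x := x) hM (h.trans h'.symm)
      ((abs_le_mul_intBracket _ _).trans hl)
      ((abs_le_mul_intBracket _ _).trans (le_of_eq_of_le (mul_comm _ _) hl))
      ((abs_le_mul_intBracket _ _).trans hr)
      ((abs_le_mul_intBracket _ _).trans (le_of_eq_of_le (mul_comm _ _) hr))
      (by simp only at h; rw [h]; rcases max_choice (intBracket (x + u) * intBracket (x + u + v))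
            (intBracket (x + u') * intBracket (x + u' + v')) with e | e <;>
          rw [hMdef, e] <;> assumption)
    left
    simpa [Prod.ext_iff] using this

theorem AdmissibleWeight.comp_swap {N : ℤ × ℤ → ℝ} (hN : AdmissibleWeight N) :
    AdmissibleWeight (fun y => N y.swap) where
  one_le y := hN.one_le _
  tsum_rpow s := by
    rw [← hN.tsum_rpow s]
    exact (Equiv.prodComm ℤ ℤ).tsum_eq (fun y => ENNReal.ofReal (N y ^ (-s)))
  unique m p q hp hq h1 h2 := by
    rcases hN.unique m p.swap q.swap (by simpa [mul_comm] using hp) (by simpa [mul_comm] using hq)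
      h1 h2 with h | h
    · exact Or.inl (Prod.swap_injective h)
    · exact Or.inr (by simpa using congrArg Prod.swap h)

/-- The divisor bound, in the form in which it is used: the resonant sum of the weight `N ^ (-δ)`
over the pairs with nonzero product is bounded for every positive exponent `δ`, although the
sum of the weight itself diverges for small `δ`. -/
theorem exists_tsum_admissibleWeight_mul_gaussKernel_le {δ κ₀ : ℝ} (hδ : 0 < δ) (h₀ : 0 < κ₀) :
    ∃ C : ℝ≥0∞, C ≠ ⊤ ∧ ∀ N, AdmissibleWeight N → ∀ κ l : ℝ, κ₀ ≤ |κ| →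
      ∑' y : ℤ × ℤ, (if y.1 * y.2 ≠ 0 then ENNReal.ofReal (N y ^ (-δ)) else 0) *
        gaussKernel (κ * (y.1 * y.2 : ℤ) + l) ≤ C := by
  obtain ⟨C₁, hC₁, h₁⟩ := exists_tsum_factorization_le hδ
  obtain ⟨C₂, hC₂, h₂⟩ := exists_tsum_gaussKernel_le h₀
  refine ⟨C₁ * C₂, ENNReal.mul_ne_top hC₁ hC₂, fun N hN κ l hκ => ?_⟩
  have e : ∀ y : ℤ × ℤ, (if y.1 * y.2 ≠ 0 then ENNReal.ofReal (N y ^ (-δ)) else 0) *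
        gaussKernel (κ * (y.1 * y.2 : ℤ) + l) =
      ∑' m : ℤ, (if m ≠ 0 then (if y.1 * y.2 = m then ENNReal.ofReal (N y ^ (-δ)) else 0) else 0) *
        gaussKernel (κ * m + l) := by
    intro y
    rw [tsum_eq_single (y.1 * y.2)]
    · simp
    · intro m hm
      rw [if_neg (c := y.1 * y.2 = m) hm.symm]
      simp
  simp_rw [e]
  rw [ENNReal.tsum_comm]
  simp_rw [ENNReal.tsum_mul_right]
  calc _ ≤ ∑' m : ℤ, C₁ * gaussKernel (κ * m + l) := by
        refine ENNReal.tsum_le_tsum fun m => mul_le_mul' ?_ le_rfl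
        by_cases hm : m = 0
        · simp [hm]
        · simp only [ne_eq, hm, not_false_eq_true, if_true]
          exact h₁ m hm N hN.one_le (hN.unique m)
    _ ≤ C₁ * C₂ := by
        rw [ENNReal.tsum_mul_left]
        exact mul_le_mul' le_rfl (h₂ κ l hκ)

/-- A summable weight on the pairs of coordinates `(u, v)` with `u v = 0`: if one of the two vanishes,
the other one carries the weight. -/
noncomputable def zeroWeight (s : ℝ) (x : ℤ) (y : ℤ × ℤ) : ℝ≥0∞ :=
  (if y.1 = 0 then intWeight s (x + y.2) else 0) + (if y.2 = 0 then intWeight s (x + y.1) else 0)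

/-- A weight on pairs of coordinates whose resonant sums are bounded, because fixing the weighted
coordinate leaves a sum over an arithmetic progression. -/
noncomputable def lineWeight (s : ℝ) (x : ℤ) (y : ℤ × ℤ) : ℝ≥0∞ :=
  zeroWeight s x y + ((if y.1 ≠ 0 then intWeight s (x + y.1) else 0) +
    (if y.2 ≠ 0 then intWeight s (x + y.2) else 0))

theorem tsum_zeroWeight (s : ℝ) (x : ℤ) :
    ∑' y, zeroWeight s x y = 2 * ∑' n, intWeight s n := by
  have e : ∀ y : ℤ × ℤ, zeroWeight s x y =
      (if y.1 = 0 then 1 else 0) * intWeight s (x + y.2) +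
        intWeight s (x + y.1) * (if y.2 = 0 then 1 else 0) := by
    intro y; simp [zeroWeight]
  simp_rw [e]
  rw [ENNReal.tsum_add,
    tsum_prod_mul (fun n => if n = 0 then 1 else 0) (fun n => intWeight s (x + n)),
    tsum_prod_mul (fun n => intWeight s (x + n)) (fun n => if n = 0 then 1 else 0),
    tsum_ite_eq, tsum_intWeight_add_left]
  ring

theorem exists_tsum_lineWeight_mul_gaussKernel_le {s κ₀ : ℝ} (hs : 1 < s) (h₀ : 0 < κ₀) :
    ∃ C : ℝ≥0∞, C ≠ ⊤ ∧ ∀ (x : ℤ) (κ l : ℝ), κ₀ ≤ |κ| →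
      ∑' y : ℤ × ℤ, lineWeight s x y * gaussKernel (κ * (y.1 * y.2 : ℤ) + l) ≤ C := by
  obtain ⟨C₂, hC₂, h₂⟩ := exists_tsum_gaussKernel_le h₀
  set A := ∑' n, intWeight s n with hA
  have hA' : A ≠ ⊤ := tsum_intWeight_ne_top hs
  refine ⟨2 * A + (A * C₂ + A * C₂), by finiteness, fun x κ l hκ => ?_⟩
  have hline : ∑' n, ∑' m : ℤ, (if n ≠ 0 then intWeight s (x + n) else 0) *
      gaussKernel (κ * (n * m : ℤ) + l) ≤ A * C₂ := by
    rw [hA, ← tsum_intWeight_add_left s x, ← ENNReal.tsum_mul_right]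
    refine ENNReal.tsum_le_tsum fun n => ?_
    by_cases hn : n = 0
    · simp [hn]
    · simp only [ne_eq, hn, not_false_eq_true, if_true, ENNReal.tsum_mul_left]
      refine mul_le_mul' le_rfl ?_
      have h1 : κ₀ ≤ |κ * n| := by
        rw [abs_mul]
        refine hκ.trans (le_mul_of_one_le_right (abs_nonneg _) ?_)
        rw [← Int.cast_abs]; exact_mod_cast Int.one_le_abs hn
      refine le_of_eq_of_le ?_ (h₂ (κ * n) l h1)
      congr! 3 with m
      push_cast; ring
  simp_rw [lineWeight, add_mul]
  rw [ENNReal.tsum_add, ENNReal.tsum_add]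
  gcongr
  · rw [hA, ← tsum_zeroWeight s x]
    exact ENNReal.tsum_le_tsum fun y => mul_le_of_le_one_right' (gaussKernel_le_one _)
  · rw [ENNReal.tsum_prod (f := fun n m => (if n ≠ 0 then intWeight s (x + n) else 0) *
      gaussKernel (κ * (n * m : ℤ) + l))]
    exact hline
  · rw [ENNReal.tsum_prod (f := fun n m => (if m ≠ 0 then intWeight s (x + m) else 0) *
      gaussKernel (κ * (n * m : ℤ) + l)), ENNReal.tsum_comm]
    simp_rw [fun n m : ℤ => mul_comm n m]
    exact hline

/-- A product weight has bounded resonant sums if one factor is summable and the other one has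
bounded resonant sums at every level. -/
theorem tsum_tensor_le (f g : ℤ × ℤ → ℝ≥0∞) (κ₁ κ₂ l : ℝ) {C : ℝ≥0∞}
    (hg : ∀ l, ∑' z : ℤ × ℤ, g z * gaussKernel (κ₂ * (z.1 * z.2 : ℤ) + l) ≤ C) :
    ∑' y : (ℤ × ℤ) × (ℤ × ℤ), f y.1 * g y.2 *
      gaussKernel (κ₁ * (y.1.1 * y.1.2 : ℤ) + κ₂ * (y.2.1 * y.2.2 : ℤ) + l) ≤ (∑' y, f y) * C := by
  rw [ENNReal.tsum_prod (f := fun y z => f y * g z *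
    gaussKernel (κ₁ * (y.1 * y.2 : ℤ) + κ₂ * (z.1 * z.2 : ℤ) + l)), ← ENNReal.tsum_mul_right]
  refine ENNReal.tsum_le_tsum fun y => ?_
  simp_rw [mul_assoc, ENNReal.tsum_mul_left]
  refine mul_le_mul' le_rfl ((le_of_eq ?_).trans (hg (κ₁ * (y.1 * y.2 : ℤ) + l)))
  congr! 4
  ring

theorem tsum_tensor_swap_le (f g : ℤ × ℤ → ℝ≥0∞) (κ₁ κ₂ l : ℝ) {C : ℝ≥0∞}
    (hg : ∀ l, ∑' z : ℤ × ℤ, g z * gaussKernel (κ₁ * (z.1 * z.2 : ℤ) + l) ≤ C) :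
    ∑' y : (ℤ × ℤ) × (ℤ × ℤ), g y.1 * f y.2 *
      gaussKernel (κ₁ * (y.1.1 * y.1.2 : ℤ) + κ₂ * (y.2.1 * y.2.2 : ℤ) + l) ≤ (∑' y, f y) * C := by
  refine le_of_eq_of_le ?_ (tsum_tensor_le f g κ₂ κ₁ l hg)
  rw [← (Equiv.prodComm (ℤ × ℤ) (ℤ × ℤ)).tsum_eq]
  refine tsum_congr fun y => ?_
  simp only [Equiv.prodComm_apply, Prod.fst_swap, Prod.snd_swap]
  rw [mul_comm (g _), add_comm (κ₁ * _)]

/-! ### Weights on the lattice `ℤ²` -/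

/-- The contribution of the pairs `(u, v)` without vanishing coordinates: of the exponent `2α`, the
share `α + 1/2 > 1` goes to one coordinate, which becomes summable, and `α - 1/2 > 0` to the other. -/
theorem exists_tsum_admissibleWeight_prod_le {α κ₀ : ℝ} (hα : 1 / 2 < α) (h₀ : 0 < κ₀) :
    ∃ C : ℝ≥0∞, C ≠ ⊤ ∧ ∀ N₁ N₂, AdmissibleWeight N₁ → AdmissibleWeight N₂ →
      ∀ κ₁ κ₂ l : ℝ, κ₀ ≤ |κ₁| → κ₀ ≤ |κ₂| →
      ∑' y : (ℤ × ℤ) × (ℤ × ℤ), (if y.1.1 * y.1.2 ≠ 0 ∧ y.2.1 * y.2.2 ≠ 0 then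
        ENNReal.ofReal ((N₁ y.1 * N₂ y.2) ^ (-α)) else 0) *
        gaussKernel (κ₁ * (y.1.1 * y.1.2 : ℤ) + κ₂ * (y.2.1 * y.2.2 : ℤ) + l) ≤ C := by
  set δ : ℝ := α - 1 / 2 with hδ
  obtain ⟨C, hC, h⟩ := exists_tsum_admissibleWeight_mul_gaussKernel_le (δ := δ) (by linarith) h₀
  have hA := tsum_intWeight_ne_top (s := α + 1 / 2) (by linarith)
  set A := ∑' n, intWeight (α + 1 / 2) n with hAdef
  refine ⟨A ^ 2 * C + A ^ 2 * C, by finiteness, fun N₁ N₂ h₁ h₂ κ₁ κ₂ l hκ₁ hκ₂ => ?_⟩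
  -- for `X, Y ≥ 1`, the larger one takes the smaller exponent
  have key : ∀ X Y : ℝ, 1 ≤ X → 1 ≤ Y → ENNReal.ofReal ((X * Y) ^ (-α)) ≤
      ENNReal.ofReal (X ^ (-(α + 1 / 2))) * ENNReal.ofReal (Y ^ (-δ)) +
      ENNReal.ofReal (X ^ (-δ)) * ENNReal.ofReal (Y ^ (-(α + 1 / 2))) := by
    have aux : ∀ X Y : ℝ, 1 ≤ X → X ≤ Y →
        (X * Y) ^ (-α) ≤ X ^ (-(α + 1 / 2)) * Y ^ (-δ) := by
      intro X Y hX hXY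
      have hX0 : 0 < X := by linarith
      have hY0 : 0 < Y := by linarith
      have e1 : X ^ (-α) = X ^ (-(α + 1 / 2)) * X ^ ((1 : ℝ) / 2) := by
        rw [← Real.rpow_add hX0]; congr 1; ring
      have e2 : Y ^ (-δ) = Y ^ ((1 : ℝ) / 2) * Y ^ (-α) := by
        rw [← Real.rpow_add hY0]; congr 1; rw [hδ]; ring
      rw [Real.mul_rpow hX0.le hY0.le, e1, e2, mul_assoc]
      gcongr
    intro X Y hX hY
    rw [← ENNReal.ofReal_mul (by positivity), ← ENNReal.ofReal_mul (by positivity)]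
    rcases le_total X Y with hXY | hXY
    · exact le_add_right (ENNReal.ofReal_le_ofReal (aux X Y hX hXY))
    · refine le_add_left (ENNReal.ofReal_le_ofReal ?_)
      rw [mul_comm X Y, mul_comm (X ^ _)]
      exact aux Y X hY hXY
  have hN : ∀ N, AdmissibleWeight N → ∑' y, ENNReal.ofReal (N y ^ (-(α + 1 / 2))) = A ^ 2 :=
    fun N hN => hN.tsum_rpow _
  calc _ ≤ ∑' y : (ℤ × ℤ) × (ℤ × ℤ),
        (ENNReal.ofReal (N₁ y.1 ^ (-(α + 1 / 2))) *
          (if y.2.1 * y.2.2 ≠ 0 then ENNReal.ofReal (N₂ y.2 ^ (-δ)) else 0) *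
          gaussKernel (κ₁ * (y.1.1 * y.1.2 : ℤ) + κ₂ * (y.2.1 * y.2.2 : ℤ) + l) +
        (if y.1.1 * y.1.2 ≠ 0 then ENNReal.ofReal (N₁ y.1 ^ (-δ)) else 0) *
          ENNReal.ofReal (N₂ y.2 ^ (-(α + 1 / 2))) *
          gaussKernel (κ₁ * (y.1.1 * y.1.2 : ℤ) + κ₂ * (y.2.1 * y.2.2 : ℤ) + l)) := by
        refine ENNReal.tsum_le_tsum fun y => ?_
        rw [← add_mul]
        refine mul_le_mul' ?_ le_rfl
        by_cases h : y.1.1 * y.1.2 ≠ 0 ∧ y.2.1 * y.2.2 ≠ 0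
        · rw [if_pos h, if_pos h.1, if_pos h.2]
          exact key _ _ (h₁.one_le _) (h₂.one_le _)
        · rw [if_neg h]
          exact bot_le
    _ ≤ A ^ 2 * C + A ^ 2 * C := by
        rw [ENNReal.tsum_add]
        refine add_le_add ?_ ?_
        · rw [← hN N₁ h₁]
          exact tsum_tensor_le _ _ κ₁ κ₂ l fun l => h N₂ h₂ κ₂ l hκ₂
        · rw [← hN N₂ h₂]
          exact tsum_tensor_swap_le _ _ κ₁ κ₂ l fun l => h N₁ h₁ κ₁ l hκ₁

theorem japaneseBracket_sq (ξ : Lattice) :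
    japaneseBracket ξ ^ 2 = 1 + ((ξ 0 : ℝ) ^ 2 + (ξ 1 : ℝ) ^ 2) := by
  rw [japaneseBracket, Real.sq_sqrt (by positivity), Fin.sum_univ_two]

theorem one_le_japaneseBracket (ξ : Lattice) : 1 ≤ japaneseBracket ξ :=
  Real.one_le_sqrt.mpr (by have : 0 ≤ ∑ i, (ξ i : ℝ) ^ 2 := by positivity
                           linarith)

theorem japaneseBracket_pos (ξ : Lattice) : 0 < japaneseBracket ξ :=
  zero_lt_one.trans_le (one_le_japaneseBracket ξ)

theorem intBracket_le_japaneseBracket (ξ : Lattice) (i : Fin 2) :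
    intBracket (ξ i) ≤ japaneseBracket ξ := by
  refine Real.sqrt_le_sqrt ?_
  gcongr
  exact Finset.single_le_sum (f := fun i => (ξ i : ℝ) ^ 2) (fun _ _ => by positivity)
    (Finset.mem_univ i)

theorem intBracket_mul_le_japaneseBracket_sq (ξ : Lattice) :
    intBracket (ξ 0) * intBracket (ξ 1) ≤ japaneseBracket ξ ^ 2 := by
  rw [sq]
  have := one_le_intBracket (ξ 1)
  have := japaneseBracket_pos ξ
  exact mul_le_mul (intBracket_le_japaneseBracket _ _) (intBracket_le_japaneseBracket _ _)
    (by linarith) (by linarith)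

/-- The weight `⟨ξ⟩ ^ (-s)` on `ℤ²`, with values in `ℝ≥0∞`. -/
noncomputable def latticeWeight (s : ℝ) (ξ : Lattice) : ℝ≥0∞ :=
  ENNReal.ofReal (japaneseBracket ξ ^ (-s))

theorem latticeWeight_le_intWeight {s : ℝ} (hs : 0 ≤ s) (ξ : Lattice) (i : Fin 2) :
    latticeWeight s ξ ≤ intWeight s (ξ i) :=
  ENNReal.ofReal_le_ofReal (Real.rpow_le_rpow_of_nonpos
    (by linarith [one_le_intBracket (ξ i)]) (intBracket_le_japaneseBracket ξ i) (by linarith))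

theorem latticeWeight_mul_le {α : ℝ} (hα : 0 ≤ α) (p q : Lattice) :
    latticeWeight (2 * α) p * latticeWeight (2 * α) q ≤
      ENNReal.ofReal (((intBracket (p 0) * intBracket (q 0)) *
        (intBracket (p 1) * intBracket (q 1))) ^ (-α)) := by
  have h1 := japaneseBracket_pos p
  have h2 := japaneseBracket_pos q
  have h3 := fun n => one_le_intBracket n
  rw [latticeWeight, latticeWeight, ← ENNReal.ofReal_mul (by positivity)]
  apply ENNReal.ofReal_le_ofReal
  rw [← Real.mul_rpow h1.le h2.le, show -(2 * α) = (2 : ℕ) * (-α) by push_cast; ring,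
    Real.rpow_mul (by positivity), Real.rpow_natCast, mul_pow]
  refine Real.rpow_le_rpow_of_nonpos ?_ ?_ (by linarith)
  · have := h3 (p 0); have := h3 (q 0); have := h3 (p 1); have := h3 (q 1)
    positivity
  · calc _ = (intBracket (p 0) * intBracket (p 1)) * (intBracket (q 0) * intBracket (q 1)) := by
          ring
      _ ≤ _ := by
          have := h3 (q 0); have := h3 (q 1)
          gcongr <;> exact intBracket_mul_le_japaneseBracket_sq _

/-- The weight `(⟨ξ⟩ / (⟨ξ + u⟩ ⟨ξ + v⟩ ⟨ξ + u + v⟩)) ^ (2 α)` of the interaction of the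
frequencies `ξ + u`, `ξ + v` and `ξ + u + v` that produces the frequency `ξ`. -/
noncomputable def interactionWeight (α : ℝ) (ξ u v : Lattice) : ℝ :=
  (japaneseBracket ξ /
    (japaneseBracket (ξ + u) * japaneseBracket (ξ + v) * japaneseBracket (ξ + u + v))) ^ (2 * α)

theorem interactionWeight_nonneg (α : ℝ) (ξ u v : Lattice) : 0 ≤ interactionWeight α ξ u v := by
  have := fun ξ => japaneseBracket_pos ξ
  have h1 := this ξ; have h2 := this (ξ + u); have h3 := this (ξ + v); have h4 := this (ξ + u + v)
  unfold interactionWeight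
  positivity

theorem div_rpow_le_of_le {α A X P Q R : ℝ} (hα : 0 ≤ α) (hX : 0 < X) (hP : 0 < P) (hQ : 0 < Q)
    (hR : 0 < R) (hA : 0 < A) (h : X ≤ A * R) :
    (X / (P * Q * R)) ^ (2 * α) ≤ A ^ (2 * α) * (P ^ (-(2 * α)) * Q ^ (-(2 * α))) := by
  calc (X / (P * Q * R)) ^ (2 * α) ≤ (A * (P⁻¹ * Q⁻¹)) ^ (2 * α) := by
        gcongr
        rw [div_le_iff₀ (by positivity)]
        calc X ≤ A * R := h
          _ = _ := by field_simp
    _ = _ := by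
        rw [Real.mul_rpow (by positivity) (by positivity),
          Real.mul_rpow (by positivity) (by positivity), Real.rpow_neg hP.le, Real.rpow_neg hQ.le,
          Real.inv_rpow hP.le, Real.inv_rpow hQ.le]

/-- The interacting frequencies satisfy `ξ = (ξ + u) + (ξ + v) - (ξ + u + v)`, so one of them is
comparable to `ξ` or larger. -/
theorem japaneseBracket_le_three_mul_max (ξ u v : Lattice) :
    japaneseBracket ξ ≤ 3 * japaneseBracket (ξ + u) ∨
    japaneseBracket ξ ≤ 3 * japaneseBracket (ξ + v) ∨
    japaneseBracket ξ ≤ 3 * japaneseBracket (ξ + u + v) := by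
  by_contra! h
  obtain ⟨h1, h2, h3⟩ := h
  have hsq : ∀ η, 3 * japaneseBracket η < japaneseBracket ξ →
      9 * japaneseBracket η ^ 2 < japaneseBracket ξ ^ 2 := by
    intro η h
    nlinarith [japaneseBracket_pos η, japaneseBracket_pos ξ]
  have g1 := hsq _ h1
  have g2 := hsq _ h2
  have g3 := hsq _ h3
  rw [japaneseBracket_sq, japaneseBracket_sq] at g1 g2 g3
  simp only [Pi.add_apply, Int.cast_add] at g1 g2 g3
  have tri : ∀ a b c : ℝ, (a + b - c) ^ 2 ≤ 3 * (a ^ 2 + b ^ 2 + c ^ 2) := fun a b c => by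
    nlinarith [sq_nonneg (a - b), sq_nonneg (a + c), sq_nonneg (b + c)]
  have t0 := tri (ξ 0 + u 0) (ξ 0 + v 0) (ξ 0 + u 0 + v 0)
  have t1 := tri (ξ 1 + u 1) (ξ 1 + v 1) (ξ 1 + u 1 + v 1)
  rw [show (ξ 0 : ℝ) + u 0 + (ξ 0 + v 0) - (ξ 0 + u 0 + v 0) = ξ 0 by ring] at t0
  rw [show (ξ 1 : ℝ) + u 1 + (ξ 1 + v 1) - (ξ 1 + u 1 + v 1) = ξ 1 by ring] at t1
  nlinarith

theorem ofReal_interactionWeight_le_of_le {α : ℝ} (hα : 0 ≤ α) {ξ u v p q r : Lattice}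
    (hpqr : japaneseBracket (ξ + u) * japaneseBracket (ξ + v) * japaneseBracket (ξ + u + v) =
      japaneseBracket p * japaneseBracket q * japaneseBracket r)
    (h : japaneseBracket ξ ≤ 3 * japaneseBracket r) :
    ENNReal.ofReal (interactionWeight α ξ u v) ≤
      ENNReal.ofReal (3 ^ (2 * α)) * (latticeWeight (2 * α) p * latticeWeight (2 * α) q) := by
  have h1 := japaneseBracket_pos p
  have h2 := japaneseBracket_pos q
  rw [latticeWeight, latticeWeight, ← ENNReal.ofReal_mul (by positivity),
    ← ENNReal.ofReal_mul (by positivity), interactionWeight, hpqr]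
  exact ENNReal.ofReal_le_ofReal (div_rpow_le_of_le hα (japaneseBracket_pos _)
    (japaneseBracket_pos _) (japaneseBracket_pos _) (japaneseBracket_pos _) (by norm_num) h)

/-! ### The resonant lattice sum -/

theorem latticeWeight_add_le {s : ℝ} (hs : 0 ≤ s) (ξ u : Lattice) (i : Fin 2) :
    latticeWeight s (ξ + u) ≤ intWeight s (ξ i + u i) :=
  latticeWeight_le_intWeight hs (ξ + u) i

theorem intWeight_le_zeroWeight_fst {s : ℝ} {x u v : ℤ} (h : u = 0) :
    intWeight s (x + v) ≤ zeroWeight s x (u, v) := by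
  rw [zeroWeight, if_pos h]; exact le_self_add

theorem intWeight_le_zeroWeight_snd {s : ℝ} {x u v : ℤ} (h : v = 0) :
    intWeight s (x + u) ≤ zeroWeight s x (u, v) := by
  rw [zeroWeight, if_pos h]; exact le_add_self

theorem zeroWeight_le_lineWeight (s : ℝ) (x : ℤ) (y : ℤ × ℤ) :
    zeroWeight s x y ≤ lineWeight s x y := le_self_add

theorem intWeight_le_lineWeight_fst {s : ℝ} {x u v : ℤ} (h : u ≠ 0) :
    intWeight s (x + u) ≤ lineWeight s x (u, v) := by
  rw [lineWeight, if_pos h]; exact le_add_left le_self_add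

theorem intWeight_le_lineWeight_snd {s : ℝ} {x u v : ℤ} (h : v ≠ 0) :
    intWeight s (x + v) ≤ lineWeight s x (u, v) := by
  rw [lineWeight, if_pos h]; exact le_add_left le_add_self

theorem zeroWeight_swap (s : ℝ) (x : ℤ) (y : ℤ × ℤ) :
    zeroWeight s x y.swap = zeroWeight s x y := by
  simp only [zeroWeight, Prod.fst_swap, Prod.snd_swap]
  rw [add_comm]

theorem lineWeight_swap (s : ℝ) (x : ℤ) (y : ℤ × ℤ) :
    lineWeight s x y.swap = lineWeight s x y := by
  simp only [lineWeight, zeroWeight_swap, Prod.fst_swap, Prod.snd_swap]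
  rw [add_comm (if y.2 ≠ 0 then _ else _)]

/-- The part of the bound for the interaction weight that is carried by the pairs `(u, v)` with
`u i * v i = 0` for some coordinate `i`. -/
noncomputable def degenerateWeight (s : ℝ) (ξ u v : Lattice) : ℝ≥0∞ :=
  zeroWeight s (ξ 0) (u 0, v 0) * lineWeight s (ξ 1) (u 1, v 1) +
    lineWeight s (ξ 0) (u 0, v 0) * zeroWeight s (ξ 1) (u 1, v 1)

theorem degenerateWeight_swap (s : ℝ) (ξ u v : Lattice) :
    degenerateWeight s ξ v u = degenerateWeight s ξ u v := by
  simp only [degenerateWeight, ← zeroWeight_swap s _ (v _, u _), ← lineWeight_swap s _ (v _, u _),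
    Prod.swap_prod_mk]

/-- The part of the bound for the interaction weight that is carried by the pairs `(u, v)` with
`u i * v i ≠ 0` for both coordinates `i`. -/
noncomputable def generalWeight (α : ℝ) (N₁ N₂ : ℤ × ℤ → ℝ) (y : (ℤ × ℤ) × (ℤ × ℤ)) : ℝ≥0∞ :=
  if y.1.1 * y.1.2 ≠ 0 ∧ y.2.1 * y.2.2 ≠ 0 then ENNReal.ofReal ((N₁ y.1 * N₂ y.2) ^ (-α)) else 0

theorem mul_le_degenerateWeight_left {s : ℝ} {ξ u v : Lattice} {a b : ℝ≥0∞}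
    (ha : a ≤ zeroWeight s (ξ 0) (u 0, v 0)) (hb : b ≤ lineWeight s (ξ 1) (u 1, v 1)) :
    a * b ≤ degenerateWeight s ξ u v :=
  (mul_le_mul' ha hb).trans le_self_add

theorem mul_le_degenerateWeight_right {s : ℝ} {ξ u v : Lattice} {a b : ℝ≥0∞}
    (ha : a ≤ lineWeight s (ξ 0) (u 0, v 0)) (hb : b ≤ zeroWeight s (ξ 1) (u 1, v 1)) :
    a * b ≤ degenerateWeight s ξ u v :=
  (mul_le_mul' ha hb).trans le_add_self

theorem ne_zero_of_coord_eq_zero {u : Lattice} (hu : u ≠ 0) : u 0 = 0 → u 1 ≠ 0 := by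
  intro h0 h1
  apply hu
  funext i
  fin_cases i <;> assumption

/-- The bound when `⟨ξ + u + v⟩` compensates `⟨ξ⟩`. -/
theorem latticeWeight_mul_le_near_near {α : ℝ} (hα : 0 ≤ α) {ξ u v : Lattice} (hu : u ≠ 0)
    (hv : v ≠ 0) :
    latticeWeight (2 * α) (ξ + u) * latticeWeight (2 * α) (ξ + v) ≤
      degenerateWeight (2 * α) ξ u v +
      generalWeight α (fun y => intBracket (ξ 0 + y.1) * intBracket (ξ 0 + y.2))
        (fun y => intBracket (ξ 1 + y.1) * intBracket (ξ 1 + y.2)) ((u 0, v 0), (u 1, v 1)) := by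
  have h2 : 0 ≤ 2 * α := by linarith
  have hu' := ne_zero_of_coord_eq_zero hu
  have hv' := ne_zero_of_coord_eq_zero hv
  have wt := fun p i => latticeWeight_add_le h2 ξ p i
  by_cases h : u 0 * v 0 ≠ 0 ∧ u 1 * v 1 ≠ 0
  · refine le_add_left ?_
    rw [generalWeight, if_pos h]
    exact latticeWeight_mul_le hα _ _
  · refine le_add_right ?_
    by_cases u0 : u 0 = 0
    · rw [mul_comm]
      exact mul_le_degenerateWeight_left
        ((wt v 0).trans (intWeight_le_zeroWeight_fst u0))
        ((wt u 1).trans (intWeight_le_lineWeight_fst (hu' u0)))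
    by_cases v0 : v 0 = 0
    · exact mul_le_degenerateWeight_left
        ((wt u 0).trans (intWeight_le_zeroWeight_snd v0))
        ((wt v 1).trans (intWeight_le_lineWeight_snd (hv' v0)))
    by_cases u1 : u 1 = 0
    · exact mul_le_degenerateWeight_right
        ((wt u 0).trans (intWeight_le_lineWeight_fst u0))
        ((wt v 1).trans (intWeight_le_zeroWeight_fst u1))
    by_cases v1 : v 1 = 0
    · rw [mul_comm]
      exact mul_le_degenerateWeight_right
        ((wt v 0).trans (intWeight_le_lineWeight_snd v0))
        ((wt u 1).trans (intWeight_le_zeroWeight_snd v1))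
    exact absurd ⟨mul_ne_zero u0 v0, mul_ne_zero u1 v1⟩ h

/-- The bound when `⟨ξ + v⟩` compensates `⟨ξ⟩`. -/
theorem latticeWeight_mul_le_near_sum {α : ℝ} (hα : 0 ≤ α) {ξ u v : Lattice} (hu : u ≠ 0)
    (hv : v ≠ 0) :
    latticeWeight (2 * α) (ξ + u) * latticeWeight (2 * α) (ξ + u + v) ≤
      degenerateWeight (2 * α) ξ u v +
      generalWeight α (fun y => intBracket (ξ 0 + y.1) * intBracket (ξ 0 + y.1 + y.2))
        (fun y => intBracket (ξ 1 + y.1) * intBracket (ξ 1 + y.1 + y.2))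
        ((u 0, v 0), (u 1, v 1)) := by
  have h2 : 0 ≤ 2 * α := by linarith
  have hu' := ne_zero_of_coord_eq_zero hu
  have hv' := ne_zero_of_coord_eq_zero hv
  have wt := fun p i => latticeWeight_add_le h2 ξ p i
  -- if one of the shifts vanishes in a coordinate, `ξ + u + v` has the coordinate of the other
  have wu : ∀ i, u i = 0 → latticeWeight (2 * α) (ξ + u + v) ≤ intWeight (2 * α) (ξ i + v i) :=
    fun i hi => (latticeWeight_le_intWeight h2 (ξ + u + v) i).trans (by simp [hi])
  have wv : ∀ i, v i = 0 → latticeWeight (2 * α) (ξ + u + v) ≤ intWeight (2 * α) (ξ i + u i) :=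
    fun i hi => (latticeWeight_le_intWeight h2 (ξ + u + v) i).trans (by simp [hi])
  by_cases h : u 0 * v 0 ≠ 0 ∧ u 1 * v 1 ≠ 0
  · refine le_add_left ?_
    rw [generalWeight, if_pos h]
    exact latticeWeight_mul_le hα _ _
  · refine le_add_right ?_
    by_cases u0 : u 0 = 0
    · rw [mul_comm]
      exact mul_le_degenerateWeight_left
        ((wu 0 u0).trans (intWeight_le_zeroWeight_fst u0))
        ((wt u 1).trans (intWeight_le_lineWeight_fst (hu' u0)))
    by_cases u1 : u 1 = 0
    · exact mul_le_degenerateWeight_right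
        ((wt u 0).trans (intWeight_le_lineWeight_fst u0))
        ((wu 1 u1).trans (intWeight_le_zeroWeight_fst u1))
    by_cases v0 : v 0 = 0
    · rw [mul_comm]
      exact mul_le_degenerateWeight_left
        ((wv 0 v0).trans (intWeight_le_zeroWeight_snd v0))
        ((wt u 1).trans (intWeight_le_lineWeight_fst u1))
    by_cases v1 : v 1 = 0
    · exact mul_le_degenerateWeight_right
        ((wt u 0).trans (intWeight_le_lineWeight_fst u0))
        ((wv 1 v1).trans (intWeight_le_zeroWeight_snd v1))
    exact absurd ⟨mul_ne_zero u0 v0, mul_ne_zero u1 v1⟩ h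

/-- The sum of the three general weights, one for each choice of the one of `⟨ξ + u⟩`,
`⟨ξ + v⟩`, `⟨ξ + u + v⟩` that compensates `⟨ξ⟩`. -/
noncomputable def generalWeightSum (α : ℝ) (ξ : Lattice) (y : (ℤ × ℤ) × (ℤ × ℤ)) : ℝ≥0∞ :=
  generalWeight α (fun y => intBracket (ξ 0 + y.1) * intBracket (ξ 0 + y.2))
      (fun y => intBracket (ξ 1 + y.1) * intBracket (ξ 1 + y.2)) y +
    (generalWeight α (fun y => intBracket (ξ 0 + y.1) * intBracket (ξ 0 + y.1 + y.2))
      (fun y => intBracket (ξ 1 + y.1) * intBracket (ξ 1 + y.1 + y.2)) y +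
    generalWeight α (fun y => intBracket (ξ 0 + y.swap.1) * intBracket (ξ 0 + y.swap.1 + y.swap.2))
      (fun y => intBracket (ξ 1 + y.swap.1) * intBracket (ξ 1 + y.swap.1 + y.swap.2)) y)

/-- The interaction weight is bounded by weights in product form. For `u = 0` or `v = 0` the weight
of the compensating bracket must not be discarded: there `⟨ξ⟩` cancels exactly, and two equal
brackets remain. -/
theorem ofReal_interactionWeight_le {α : ℝ} (hα : 0 ≤ α) (ξ u v : Lattice) :
    ENNReal.ofReal (interactionWeight α ξ u v) ≤ ENNReal.ofReal (3 ^ (2 * α)) *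
      (degenerateWeight (2 * α) ξ u v + generalWeightSum α ξ ((u 0, v 0), (u 1, v 1))) := by
  have h2 : 0 ≤ 2 * α := by linarith
  have wt := fun p i => latticeWeight_add_le h2 ξ p i
  have pos := japaneseBracket_pos
  by_cases hu : u = 0
  · subst hu
    refine (ofReal_interactionWeight_le_of_le hα (p := ξ + v) (q := ξ + v) (r := ξ) ?_ ?_).trans
      (mul_le_mul' le_rfl (le_add_right ?_))
    · simp; ring
    · linarith [pos ξ]
    · exact mul_le_degenerateWeight_left
        ((wt v 0).trans (intWeight_le_zeroWeight_fst rfl))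
        ((wt v 1).trans ((intWeight_le_zeroWeight_fst rfl).trans
          (zeroWeight_le_lineWeight _ _ _)))
  by_cases hv : v = 0
  · subst hv
    refine (ofReal_interactionWeight_le_of_le hα (p := ξ + u) (q := ξ + u) (r := ξ) ?_ ?_).trans
      (mul_le_mul' le_rfl (le_add_right ?_))
    · simp; ring
    · linarith [pos ξ]
    · exact mul_le_degenerateWeight_left
        ((wt u 0).trans (intWeight_le_zeroWeight_snd rfl))
        ((wt u 1).trans ((intWeight_le_zeroWeight_snd rfl).trans
          (zeroWeight_le_lineWeight _ _ _)))
  rcases japaneseBracket_le_three_mul_max ξ u v with h | h | h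
  · refine (ofReal_interactionWeight_le_of_le hα (p := ξ + v) (q := ξ + v + u) ?_ h).trans
      (mul_le_mul' le_rfl ((latticeWeight_mul_le_near_sum hα hv hu).trans ?_))
    · rw [add_right_comm ξ v u]; ring
    · rw [degenerateWeight_swap]
      refine add_le_add le_rfl (le_add_left (le_add_left (le_of_eq ?_)))
      simp only [generalWeight, Prod.fst_swap, Prod.snd_swap, mul_comm (u _)]
  · refine (ofReal_interactionWeight_le_of_le hα (p := ξ + u) (q := ξ + u + v) ?_ h).trans
      (mul_le_mul' le_rfl ((latticeWeight_mul_le_near_sum hα hu hv).trans ?_))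
    · ring
    · exact add_le_add le_rfl (le_add_left le_self_add)
  · refine (ofReal_interactionWeight_le_of_le hα (p := ξ + u) (q := ξ + v) ?_ h).trans
      (mul_le_mul' le_rfl ((latticeWeight_mul_le_near_near hα hu hv).trans ?_))
    · ring
    · exact add_le_add le_rfl le_self_add

/-- The resonant sum of the interaction weight is bounded uniformly in the output frequency `ξ` and
in the level `l`. -/
theorem exists_tsum_interactionWeight_le {α κ₀ : ℝ} (hα : 1 / 2 < α) (h₀ : 0 < κ₀) :
    ∃ C : ℝ≥0∞, C ≠ ⊤ ∧ ∀ (ξ : Lattice) (κ : Fin 2 → ℝ) (l : ℝ), (∀ i, κ₀ ≤ |κ i|) →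
      ∑' p : Lattice × Lattice, ENNReal.ofReal (interactionWeight α ξ p.1 p.2) *
        gaussKernel (κ 0 * (p.1 0 * p.2 0 : ℤ) + κ 1 * (p.1 1 * p.2 1 : ℤ) + l) ≤ C := by
  obtain ⟨C₁, hC₁, h₁⟩ := exists_tsum_lineWeight_mul_gaussKernel_le (s := 2 * α) (by linarith) h₀
  obtain ⟨C₂, hC₂, h₂⟩ := exists_tsum_admissibleWeight_prod_le hα h₀
  have hA := tsum_intWeight_ne_top (s := 2 * α) (by linarith)
  set A := ∑' n, intWeight (2 * α) n with hAdef
  refine ⟨ENNReal.ofReal (3 ^ (2 * α)) * ((2 * A * C₁ + 2 * A * C₁) + (C₂ + (C₂ + C₂))),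
    by finiteness, fun ξ κ l hκ => ?_⟩
  let K : (ℤ × ℤ) × (ℤ × ℤ) → ℝ≥0∞ := fun y =>
    gaussKernel (κ 0 * (y.1.1 * y.1.2 : ℤ) + κ 1 * (y.2.1 * y.2.2 : ℤ) + l)
  let D : (ℤ × ℤ) × (ℤ × ℤ) → ℝ≥0∞ := fun y =>
    zeroWeight (2 * α) (ξ 0) y.1 * lineWeight (2 * α) (ξ 1) y.2 * K y +
    lineWeight (2 * α) (ξ 0) y.1 * zeroWeight (2 * α) (ξ 1) y.2 * K y
  let e : Lattice × Lattice → (ℤ × ℤ) × (ℤ × ℤ) := fun p => ((p.1 0, p.2 0), (p.1 1, p.2 1))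
  have he : Function.Injective e := by
    rintro ⟨u, v⟩ ⟨u', v'⟩ h
    simp only [e, Prod.mk.injEq] at h
    obtain ⟨⟨h1, h2⟩, h3, h4⟩ := h
    rw [Prod.mk.injEq]
    constructor <;> funext i <;> fin_cases i <;> assumption
  calc _ ≤ ∑' p : Lattice × Lattice, (fun y => ENNReal.ofReal (3 ^ (2 * α)) *
          (D y + generalWeightSum α ξ y * K y)) (e p) := by
        refine ENNReal.tsum_le_tsum fun p => ?_
        refine (mul_le_mul' (ofReal_interactionWeight_le (by linarith) ξ p.1 p.2) le_rfl).trans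
          (le_of_eq ?_)
        simp only [D, e, K, degenerateWeight]
        ring
    _ ≤ ∑' y, ENNReal.ofReal (3 ^ (2 * α)) * (D y + generalWeightSum α ξ y * K y) :=
        ENNReal.tsum_comp_le_tsum_of_injective he _
    _ ≤ _ := by
        rw [ENNReal.tsum_mul_left]
        gcongr
        rw [ENNReal.tsum_add]
        gcongr
        · rw [ENNReal.tsum_add]
          gcongr
          · rw [hAdef, ← tsum_zeroWeight _ (ξ 0)]
            exact tsum_tensor_le _ _ (κ 0) (κ 1) l fun l => h₁ (ξ 1) (κ 1) l (hκ 1)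
          · rw [hAdef, ← tsum_zeroWeight _ (ξ 1)]
            exact tsum_tensor_swap_le _ _ (κ 0) (κ 1) l fun l => h₁ (ξ 0) (κ 0) l (hκ 0)
        · simp_rw [generalWeightSum, add_mul]
          rw [ENNReal.tsum_add, ENNReal.tsum_add]
          gcongr
          · exact h₂ _ _ (admissibleWeight_near_near _) (admissibleWeight_near_near _) _ _ l
              (hκ 0) (hκ 1)
          · exact h₂ _ _ (admissibleWeight_near_sum _) (admissibleWeight_near_sum _) _ _ l
              (hκ 0) (hκ 1)
          · exact h₂ _ _ (admissibleWeight_near_sum _).comp_swap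
              (admissibleWeight_near_sum _).comp_swap _ _ l (hκ 0) (hκ 1)

/-! ### Characters, Bessel's inequality and the free evolution -/

theorem integral_fourier (n : ℤ) :
    ∫ x : AddCircle (2 * π), fourier n x = if n = 0 then ((2 * π : ℝ) : ℂ) else 0 := by
  split_ifs with h
  · subst h
    simp [Measure.real, AddCircle.measure_univ, Real.pi_pos.le]
  · exact integral_eq_zero_of_add_right_eq_neg (μ := volume)
      (fourier_add_half_inv_index h (fact_two_pi_pos.out))

theorem norm_character {k : ℕ} (ζ : Freq k) (p : Space k) : ‖character k ζ p‖ = 1 := by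
  simp only [character, ContinuousMap.coe_mk, norm_mul, norm_prod, fourier_apply, Circle.norm_coe,
    Finset.prod_const_one, mul_one]

theorem character_mul_conj {k : ℕ} (ζ ζ' : Freq k) (p : Space k) :
    character k ζ p * (starRingEnd ℂ) (character k ζ' p) = character k (ζ - ζ') p := by
  have h1 : ∀ (m n : ℤ) (x : AddCircle (2 * π)),
      (fourier (m - n) x : ℂ) = fourier m x * fourier (-n) x := fun m n x => by
    rw [sub_eq_add_neg, fourier_add]
  have h2 : ∀ (m n : ℤ) (x : AddCircle (2 * π)),
      (fourier (-(m - n)) x : ℂ) = fourier (-m) x * fourier (- -n) x := fun m n x => by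
    rw [← fourier_add]; congr 2; ring
  simp only [character, ContinuousMap.coe_mk, map_mul, map_prod, ← fourier_neg, Prod.fst_sub,
    Prod.snd_sub, Pi.sub_apply, h1, h2, Finset.prod_mul_distrib]
  rw [mul_mul_mul_comm]

theorem integral_character {k : ℕ} (ζ : Freq k) :
    ∫ p, character k ζ p = if ζ = 0 then (((2 * π) ^ (4 * k) : ℝ) : ℂ) else 0 := by
  simp only [character, ContinuousMap.coe_mk]
  rw [Measure.volume_eq_prod, integral_prod_mul
    (f := fun x : Fin k → Torus => ∏ j, ∏ i, fourier (ζ.1 j i) (x j i))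
    (g := fun x : Fin k → Torus => ∏ j, ∏ i, fourier (-(ζ.2 j i)) (x j i))]
  rw [integral_fintype_prod_volume_eq_prod
      (fun (j : Fin k) (x : Torus) => ∏ i, (fourier (ζ.1 j i) (x i) : ℂ)),
    integral_fintype_prod_volume_eq_prod
      (fun (j : Fin k) (x : Torus) => ∏ i, (fourier (-(ζ.2 j i)) (x i) : ℂ))]
  have e : ∀ ξ : Lattice, ∫ x : Torus, ∏ i, (fourier (ξ i) (x i) : ℂ) =
      ∏ i, if ξ i = 0 then ((2 * π : ℝ) : ℂ) else 0 := by
    intro ξ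
    rw [integral_fintype_prod_volume_eq_prod
      (fun (i : Fin 2) (x : AddCircle (2 * π)) => (fourier (ξ i) x : ℂ))]
    simp_rw [integral_fourier]
  simp_rw [e]
  split_ifs with h
  · subst h
    simp only [Prod.fst_zero, Prod.snd_zero, Pi.zero_apply, neg_zero, if_true, Finset.prod_const,
      Finset.card_univ, Fintype.card_fin]
    push_cast
    rw [← pow_mul, ← pow_add]
    congr 1
    ring
  · have h' : ζ.1 ≠ 0 ∨ ζ.2 ≠ 0 := by
      by_contra! h2
      exact h (Prod.ext h2.1 h2.2)
    rcases h' with h' | h'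
    · obtain ⟨j, hj⟩ := Function.ne_iff.mp h'
      obtain ⟨i, hi⟩ := Function.ne_iff.mp hj
      rw [Finset.prod_eq_zero (Finset.mem_univ j), zero_mul]
      exact Finset.prod_eq_zero (Finset.mem_univ i) (if_neg hi)
    · obtain ⟨j, hj⟩ := Function.ne_iff.mp h'
      obtain ⟨i, hi⟩ := Function.ne_iff.mp hj
      rw [mul_comm, Finset.prod_eq_zero (Finset.mem_univ j), zero_mul]
      exact Finset.prod_eq_zero (Finset.mem_univ i) (if_neg (neg_ne_zero.mpr hi))

/-- The total mass `(2π)^{4k}` of `Λ^k × Λ^k`. -/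
noncomputable def mass (k : ℕ) : ℝ := (2 * π) ^ (4 * k)

theorem mass_pos (k : ℕ) : 0 < mass k := by unfold mass; positivity

theorem inversionConst_eq (k : ℕ) : inversionConst k = ((mass k : ℝ) : ℂ)⁻¹ := rfl

theorem integral_character_mul_conj {k : ℕ} (ζ ζ' : Freq k) :
    ∫ p, character k ζ p * (starRingEnd ℂ) (character k ζ' p) =
      if ζ = ζ' then ((mass k : ℝ) : ℂ) else 0 := by
  simp_rw [character_mul_conj, integral_character, sub_eq_zero]
  rfl

/-- A character as an element of `L²(Λ^k × Λ^k)`. -/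
noncomputable abbrev characterLp (k : ℕ) (ζ : Freq k) : Lp ℂ 2 (volume : Measure (Space k)) :=
  ContinuousMap.toLp (E := ℂ) 2 volume ℂ (character k ζ)

theorem inner_characterLp {k : ℕ} (ζ ζ' : Freq k) :
    inner ℂ (characterLp k ζ) (characterLp k ζ') = if ζ = ζ' then ((mass k : ℝ) : ℂ) else 0 := by
  rw [ContinuousMap.inner_toLp, integral_character_mul_conj]
  simp only [eq_comm]

theorem inner_characterLp_eq_fourierTransform {k : ℕ} (ζ : Freq k)
    (f : Lp ℂ 2 (volume : Measure (Space k))) :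
    inner ℂ (characterLp k ζ) f = fourierTransform f ζ := by
  rw [L2.inner_def, fourierTransform]
  refine integral_congr_ae ?_
  filter_upwards [ContinuousMap.coeFn_toLp (p := 2) (𝕜 := ℂ) volume (character k ζ)] with p hp
  rw [hp]
  rfl

theorem fourierTransform_congr_ae {k : ℕ} {f g : DensityMatrix k} (h : f =ᵐ[volume] g)
    (ζ : Freq k) : fourierTransform f ζ = fourierTransform g ζ := by
  refine integral_congr_ae ?_
  filter_upwards [h] with p hp
  rw [hp]

theorem orthonormal_character (k : ℕ) :
    Orthonormal ℂ fun ζ : Freq k => (((Real.sqrt (mass k))⁻¹ : ℝ) : ℂ) • characterLp k ζ := by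
  rw [orthonormal_iff_ite]
  intro ζ ζ'
  rw [inner_smul_left, inner_smul_right, inner_characterLp]
  split_ifs
  · rw [Complex.conj_ofReal, ← Complex.ofReal_mul, ← Complex.ofReal_mul, ← mul_assoc, ← mul_inv,
      Real.mul_self_sqrt (mass_pos k).le, inv_mul_cancel₀ (mass_pos k).ne', Complex.ofReal_one]
  · simp

/-- Bessel's inequality for the Fourier coefficients on `Λ^k × Λ^k`. -/
theorem sum_norm_fourierTransform_sq_le {k : ℕ} {f : DensityMatrix k} (hf : MemLp f 2 volume)
    (F : Finset (Freq k)) :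
    ∑ ζ ∈ F, ‖inversionConst k * fourierTransform f ζ‖ ^ 2 ≤
      (mass k)⁻¹ * (eLpNorm f 2 volume).toReal ^ 2 := by
  have h := (orthonormal_character k).sum_inner_products_le (hf.toLp f) (s := F)
  rw [Lp.norm_toLp] at h
  have e : ∀ ζ, ‖inner ℂ ((((Real.sqrt (mass k))⁻¹ : ℝ) : ℂ) • characterLp k ζ) (hf.toLp f)‖ ^ 2 =
      mass k * ‖inversionConst k * fourierTransform f ζ‖ ^ 2 := by
    intro ζ
    rw [inner_smul_left, inner_characterLp_eq_fourierTransform,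
      fourierTransform_congr_ae hf.coeFn_toLp, inversionConst_eq, norm_mul, norm_mul,
      RCLike.norm_conj, norm_inv, Complex.norm_real, Complex.norm_real, mul_pow, mul_pow,
      Real.norm_eq_abs, sq_abs, Real.norm_eq_abs, inv_pow, inv_pow,
      Real.sq_sqrt (mass_pos k).le, sq_abs]
    have := (mass_pos k).ne'
    field_simp
  simp_rw [e] at h
  rw [← Finset.mul_sum] at h
  rwa [inv_mul_eq_div, le_div_iff₀ (mass_pos k), mul_comm]

theorem summable_norm_fourierTransform_sq {k : ℕ} {f : DensityMatrix k} (hf : MemLp f 2 volume) :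
    Summable fun ζ => ‖inversionConst k * fourierTransform f ζ‖ ^ 2 :=
  summable_of_sum_le (fun _ => by positivity) (sum_norm_fourierTransform_sq_le hf)

theorem fourierTransform_tsum {k : ℕ} {c : Freq k → ℂ} (hc : Summable fun ζ => ‖c ζ‖ ^ 2)
    (ζ : Freq k) :
    fourierTransform (⇑(∑' η, c η • characterLp k η)) ζ = (mass k : ℂ) * c ζ := by
  have hs : Summable fun η => c η • characterLp k η := by
    have h := (orthonormal_character k).orthogonalFamily.summable_iff_norm_sq_summable
      (fun η => ((Real.sqrt (mass k) : ℝ) : ℂ) * c η)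
    have hm : ((Real.sqrt (mass k) : ℝ) : ℂ) ≠ 0 := by
      simpa using (Real.sqrt_pos.mpr (mass_pos k)).ne'
    refine (h.mpr ?_).congr fun η => ?_
    · simp_rw [norm_mul, mul_pow]
      exact hc.mul_left _
    · simp only [LinearIsometry.toSpanSingleton_apply]
      rw [smul_smul]
      congr 1
      push_cast
      field_simp
  rw [← inner_characterLp_eq_fourierTransform]
  have h2 := hs.hasSum.mapL (innerSL ℂ (characterLp k ζ))
  rw [← innerSL_apply_apply ℂ, ← h2.tsum_eq, tsum_eq_single ζ]
  · simp only [innerSL_apply_apply, inner_smul_right, inner_characterLp, if_true]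
    ring
  · intro η hη
    simp only [innerSL_apply_apply, inner_smul_right, inner_characterLp, if_neg hη.symm, mul_zero]

/-- The energy `∑ Q(ξ_j) - ∑ Q(ξ'_j)`, the phase velocity of the Fourier mode `ζ = (ξ; ξ')` under
the free evolution. -/
noncomputable def energy {k : ℕ} (θ : Fin 2 → ℝ) (ζ : Freq k) : ℝ :=
  ∑ j, quadForm θ (ζ.1 j) - ∑ j, quadForm θ (ζ.2 j)

/-- The phase `exp (-i t ω)`. -/
noncomputable def phase (t ω : ℝ) : ℂ := Complex.exp (-(Complex.I * t * (ω : ℂ)))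

theorem norm_phase (t ω : ℝ) : ‖phase t ω‖ = 1 := by
  rw [phase, Complex.norm_exp]; simp

/-- The series that defines the free evolution converges, so that it has the expected Fourier
coefficients. -/
theorem fourierTransform_freeEvolution {k : ℕ} (θ : Fin 2 → ℝ) (t : ℝ) {γ : DensityMatrix k}
    (hγ : MemLp γ 2 volume) (ζ : Freq k) :
    inversionConst k * fourierTransform (⇑(freeEvolution θ t γ)) ζ =
      phase t (energy θ ζ) * (inversionConst k * fourierTransform γ ζ) := by
  have hs : Summable fun ζ : Freq k =>
      ‖inversionConst k * (phase t (energy θ ζ) * fourierTransform γ ζ)‖ ^ 2 := by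
    refine (summable_norm_fourierTransform_sq hγ).congr fun ζ => ?_
    rw [norm_mul, norm_mul, norm_mul, norm_phase, one_mul]
  have := fourierTransform_tsum hs ζ
  rw [freeEvolution]
  refine (congrArg (inversionConst k * ·) this).trans ?_
  have hm : (mass k : ℂ) ≠ 0 := by simpa using (mass_pos k).ne'
  simp only [inversionConst_eq]
  field_simp

/-! ### Trigonometric sums in space-time and the Schur test -/

theorem continuous_phase (ω : ℝ) : Continuous fun t => phase t ω := by
  unfold phase; fun_prop

theorem phase_mul_conj (t ω ω' : ℝ) :
    phase t ω * (starRingEnd ℂ) (phase t ω') = phase t (ω - ω') := by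
  simp only [phase, ← Complex.exp_conj, ← Complex.exp_add, map_neg, map_mul, Complex.conj_I,
    Complex.conj_ofReal]
  congr 1
  push_cast
  ring

theorem integrable_gaussian_mul_phase (ω : ℝ) :
    Integrable fun t : ℝ => (Real.exp (-t ^ 2) : ℂ) * phase t ω := by
  refine (integrable_cexp_quadratic (b := 1) (by simp) (-(Complex.I * ω)) 0).congr ?_
  refine Eventually.of_forall fun t => ?_
  simp only [phase]
  rw [Complex.ofReal_exp, ← Complex.exp_add]
  congr 1
  push_cast
  ring

theorem integral_gaussian_mul_phase (ω : ℝ) :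
    ∫ t : ℝ, (Real.exp (-t ^ 2) : ℂ) * phase t ω =
      ((Real.sqrt π * Real.exp (-(ω ^ 2 / 4)) : ℝ) : ℂ) := by
  have h := fourierIntegral_gaussian (b := 1) (by simp) (-ω : ℂ)
  calc _ = ∫ x : ℝ, Complex.exp (Complex.I * (-ω) * x) * Complex.exp (-1 * (x : ℂ) ^ 2) := by
        refine integral_congr_ae (Eventually.of_forall fun t => ?_)
        simp only [phase]
        rw [Complex.ofReal_exp, ← Complex.exp_add, ← Complex.exp_add]
        congr 1
        push_cast
        ring
    _ = _ := by
        rw [h, Real.sqrt_eq_rpow, Complex.ofReal_mul, Complex.ofReal_cpow Real.pi_pos.le]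
        congr 1
        · simp
        · push_cast; congr 1; ring

theorem sq_eLpNorm_two {X : Type*} [MeasurableSpace X] (μ : Measure X) (f : X → ℂ) :
    eLpNorm f 2 μ ^ 2 = ∫⁻ x, ‖f x‖ₑ ^ 2 ∂μ := by
  have := eLpNorm_nnreal_pow_eq_lintegral (f := f) (μ := μ) (p := 2) (by norm_num)
  simpa using this

/-- The trigonometric sum `∑ a_i exp (-i t ω_i) χ_{η_i}` on `ℝ × Λ^k × Λ^k`. -/
noncomputable def waveSum {ι : Type*} {k : ℕ} (F : Finset ι) (a : ι → ℂ) (ω : ι → ℝ)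
    (η : ι → Freq k) (q : ℝ × Space k) : ℂ :=
  ∑ i ∈ F, a i * phase q.1 (ω i) * character k (η i) q.2

theorem continuous_waveSum {ι : Type*} {k : ℕ} (F : Finset ι) (a : ι → ℂ) (ω : ι → ℝ)
    (η : ι → Freq k) : Continuous (waveSum F a ω η) := by
  unfold waveSum
  refine continuous_finsetSum _ fun i _ => ?_
  have := continuous_phase (ω i)
  fun_prop

theorem integrable_of_continuous {k : ℕ} {f : Space k → ℂ} (hf : Continuous f) :
    Integrable f volume :=
  hf.integrable_of_hasCompactSupport (HasCompactSupport.of_compactSpace f)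

theorem integral_norm_waveSum_sq {ι : Type*} {k : ℕ} (F : Finset ι) (a : ι → ℂ) (ω : ι → ℝ)
    (η : ι → Freq k) (t : ℝ) :
    ((∫ p, ‖waveSum F a ω η (t, p)‖ ^ 2 : ℝ) : ℂ) = (mass k : ℂ) * ∑ i ∈ F, ∑ j ∈ F,
      if η i = η j then a i * (starRingEnd ℂ) (a j) * phase t (ω i - ω j) else 0 := by
  have e : ∀ p, ((‖waveSum F a ω η (t, p)‖ ^ 2 : ℝ) : ℂ) = ∑ i ∈ F, ∑ j ∈ F,
      (a i * (starRingEnd ℂ) (a j) * phase t (ω i - ω j)) *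
        (character k (η i) p * (starRingEnd ℂ) (character k (η j) p)) := by
    intro p
    rw [Complex.ofReal_pow, ← Complex.mul_conj', waveSum, map_sum, Finset.sum_mul_sum]
    refine Finset.sum_congr rfl fun i _ => Finset.sum_congr rfl fun j _ => ?_
    rw [← phase_mul_conj]
    simp only [map_mul]
    ring
  have hint : ∀ i j, Integrable (fun p => (a i * (starRingEnd ℂ) (a j) * phase t (ω i - ω j)) *
        (character k (η i) p * (starRingEnd ℂ) (character k (η j) p))) volume := fun i j =>
    integrable_of_continuous (by fun_prop)
  rw [← integral_complex_ofReal]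
  simp_rw [e]
  rw [integral_finsetSum _ fun i _ => integrable_finsetSum _ fun j _ => hint i j, Finset.mul_sum]
  refine Finset.sum_congr rfl fun i _ => ?_
  rw [integral_finsetSum _ fun j _ => hint i j, Finset.mul_sum]
  refine Finset.sum_congr rfl fun j _ => ?_
  rw [integral_const_mul, integral_character_mul_conj]
  split_ifs <;> ring

/-- Almost orthogonality in time: after majorizing the indicator of `[0, 1]` by a Gaussian, modes
with equal frequency interact only through the Gaussian kernel of the difference of their
phase velocities. -/
theorem lintegral_enorm_waveSum_sq_le {ι : Type*} {k : ℕ} (F : Finset ι) (a : ι → ℂ) (ω : ι → ℝ)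
    (η : ι → Freq k) :
    ∫⁻ q, ‖waveSum F a ω η q‖ₑ ^ 2 ∂(slabMeasure k (Set.Icc 0 1)) ≤
      ENNReal.ofReal (Real.exp 1 * Real.sqrt π * mass k * ∑ i ∈ F, ∑ j ∈ F,
        if η i = η j then ‖a i‖ * ‖a j‖ * Real.exp (-((ω i - ω j) ^ 2 / 4)) else 0) := by
  have hcont := continuous_waveSum F a ω η
  set g : ℝ → ℝ := fun t => ∫ p, ‖waveSum F a ω η (t, p)‖ ^ 2 with hg
  have hg0 : ∀ t, 0 ≤ g t := fun t => integral_nonneg fun p => by positivity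
  have hgint : ∀ t, ∫⁻ p, ‖waveSum F a ω η (t, p)‖ₑ ^ 2 = ENNReal.ofReal (g t) := by
    intro t
    rw [hg, ofReal_integral_eq_lintegral_ofReal]
    · simp_rw [ENNReal.ofReal_pow (norm_nonneg _), ofReal_norm]
    · refine Continuous.integrable_of_hasCompactSupport (by fun_prop)
        (HasCompactSupport.of_compactSpace _)
    · exact Eventually.of_forall fun p => by positivity
  have hG : ∀ t, ((Real.exp (-t ^ 2) * g t : ℝ) : ℂ) = ∑ i ∈ F, ∑ j ∈ F,
      (mass k * if η i = η j then a i * (starRingEnd ℂ) (a j) else 0) *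
        ((Real.exp (-t ^ 2) : ℂ) * phase t (ω i - ω j)) := by
    intro t
    rw [Complex.ofReal_mul, hg, integral_norm_waveSum_sq, Finset.mul_sum, Finset.mul_sum]
    refine Finset.sum_congr rfl fun i _ => ?_
    rw [Finset.mul_sum, Finset.mul_sum]
    refine Finset.sum_congr rfl fun j _ => ?_
    split_ifs <;> ring
  have hGi : ∀ i j, Integrable fun t : ℝ =>
      (mass k * if η i = η j then a i * (starRingEnd ℂ) (a j) else 0) *
        ((Real.exp (-t ^ 2) : ℂ) * phase t (ω i - ω j)) := fun i j =>
    (integrable_gaussian_mul_phase _).const_mul _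
  have hintC : Integrable fun t => ((Real.exp (-t ^ 2) * g t : ℝ) : ℂ) := by
    simp_rw [hG]
    exact integrable_finsetSum _ fun i _ => integrable_finsetSum _ fun j _ => hGi i j
  have hintR : Integrable fun t => Real.exp (-t ^ 2) * g t := by
    exact hintC.re.congr (Eventually.of_forall fun t => Complex.ofReal_re _)
  have hval : ∫ t, Real.exp (-t ^ 2) * g t ≤ Real.sqrt π * mass k * ∑ i ∈ F, ∑ j ∈ F,
        if η i = η j then ‖a i‖ * ‖a j‖ * Real.exp (-((ω i - ω j) ^ 2 / 4)) else 0 := by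
    have h1 : ((∫ t, Real.exp (-t ^ 2) * g t : ℝ) : ℂ) = ∑ i ∈ F, ∑ j ∈ F,
        (mass k * if η i = η j then a i * (starRingEnd ℂ) (a j) else 0) *
          ((Real.sqrt π * Real.exp (-((ω i - ω j) ^ 2 / 4)) : ℝ) : ℂ) := by
      rw [← integral_complex_ofReal]
      simp_rw [hG]
      rw [integral_finsetSum _ fun i _ => integrable_finsetSum _ fun j _ => hGi i j]
      refine Finset.sum_congr rfl fun i _ => ?_
      rw [integral_finsetSum _ fun j _ => hGi i j]
      refine Finset.sum_congr rfl fun j _ => ?_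
      rw [integral_const_mul, integral_gaussian_mul_phase]
    calc _ ≤ ‖((∫ t, Real.exp (-t ^ 2) * g t : ℝ) : ℂ)‖ := by
          rw [Complex.norm_real]; exact Real.le_norm_self _
      _ ≤ _ := by
          rw [h1, Finset.mul_sum]
          refine (norm_sum_le _ _).trans (Finset.sum_le_sum fun i _ => ?_)
          rw [Finset.mul_sum]
          refine (norm_sum_le _ _).trans (Finset.sum_le_sum fun j _ => le_of_eq ?_)
          have := mass_pos k
          split_ifs
          · rw [norm_mul, norm_mul, norm_mul, RCLike.norm_conj, Complex.norm_real,
              Complex.norm_real, Real.norm_of_nonneg (by positivity),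
              Real.norm_of_nonneg (by positivity)]
            ring
          · simp
  have hmeas : Measurable fun q => ‖waveSum F a ω η q‖ₑ ^ 2 := by fun_prop
  rw [slabMeasure, lintegral_prod _ hmeas.aemeasurable]
  simp_rw [hgint]
  calc _ ≤ ∫⁻ t in Set.Icc (0 : ℝ) 1, ENNReal.ofReal (Real.exp 1 * (Real.exp (-t ^ 2) * g t)) := by
        -- `exp 1 * exp (-t ^ 2) ≥ 1` on `[0, 1]`
        refine setLIntegral_mono' measurableSet_Icc fun t ht => ENNReal.ofReal_le_ofReal ?_
        rw [← mul_assoc, ← Real.exp_add]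
        refine le_mul_of_one_le_left (hg0 t) (Real.one_le_exp ?_)
        nlinarith [ht.1, ht.2]
    _ ≤ ∫⁻ t, ENNReal.ofReal (Real.exp 1 * (Real.exp (-t ^ 2) * g t)) :=
        setLIntegral_le_lintegral _ _
    _ = ENNReal.ofReal (∫ t, Real.exp 1 * (Real.exp (-t ^ 2) * g t)) := by
        rw [ofReal_integral_eq_lintegral_ofReal (hintR.const_mul _)]
        exact Eventually.of_forall fun t => by have := hg0 t; positivity
    _ ≤ _ := by
        refine ENNReal.ofReal_le_ofReal ?_
        rw [integral_const_mul, mul_assoc (Real.exp 1), mul_assoc (Real.exp 1)]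
        exact mul_le_mul_of_nonneg_left hval (Real.exp_pos _).le

/-- The weighted Schur test for an even nonnegative kernel, restricted to pairs in the same fiber
of `η`. -/
theorem sum_sum_le_of_schur {ι κ : Type*} [DecidableEq κ] (F : Finset ι) (η : ι → κ) (ω : ι → ℝ)
    {d ρ : ι → ℝ} {B : ℝ} {K : ℝ → ℝ} (hK0 : ∀ s, 0 ≤ K s) (hK : ∀ s, K (-s) = K s)
    (hB : ∀ ν s, ∑ j ∈ F with η j = ν, K (s - ω j) * ρ j ^ 2 ≤ B) :
    (∑ i ∈ F, ∑ j ∈ F, if η i = η j then (d i * ρ i) * (d j * ρ j) * K (ω i - ω j) else 0) ≤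
      B * ∑ i ∈ F, d i ^ 2 := by
  set S : ℝ := ∑ i ∈ F, ∑ j ∈ F, if η i = η j then d i ^ 2 * (K (ω i - ω j) * ρ j ^ 2) else 0
  have hS : S ≤ B * ∑ i ∈ F, d i ^ 2 := by
    rw [Finset.mul_sum]
    refine Finset.sum_le_sum fun i _ => ?_
    rw [← Finset.sum_filter, ← Finset.mul_sum, mul_comm B]
    refine mul_le_mul_of_nonneg_left (le_of_eq_of_le ?_ (hB (η i) (ω i))) (sq_nonneg _)
    congr 1
    ext j
    simp only [Finset.mem_filter, eq_comm]
  have hS' : S = ∑ i ∈ F, ∑ j ∈ F, if η i = η j then d j ^ 2 * (K (ω i - ω j) * ρ i ^ 2) else 0 := by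
    simp only [S]
    rw [Finset.sum_comm]
    refine Finset.sum_congr rfl fun i _ => Finset.sum_congr rfl fun j _ => ?_
    rw [← neg_sub (ω i), hK]
    simp only [eq_comm]
  have h2 : 2 * (∑ i ∈ F, ∑ j ∈ F,
      if η i = η j then (d i * ρ i) * (d j * ρ j) * K (ω i - ω j) else 0) ≤ S + S := by
    nth_rewrite 2 [hS']
    simp only [S]
    rw [Finset.mul_sum, ← Finset.sum_add_distrib]
    refine Finset.sum_le_sum fun i _ => ?_
    rw [Finset.mul_sum, ← Finset.sum_add_distrib]
    refine Finset.sum_le_sum fun j _ => ?_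
    split_ifs
    · nlinarith [mul_nonneg (hK0 (ω i - ω j)) (sq_nonneg (d i * ρ j - d j * ρ i))]
    · simp
  linarith

/-- The space-time `L²` norm of a trigonometric sum is controlled by a weighted `ℓ²` norm of its
coefficients, given a bound for the resonant sums of the inverse weights over the fibers of `η`. -/
theorem eLpNorm_waveSum_le {ι : Type*} {k : ℕ} (F : Finset ι) (a : ι → ℂ) (ω : ι → ℝ)
    (η : ι → Freq k) {d ρ : ι → ℝ} {B : ℝ} (hB0 : 0 ≤ B) (ha : ∀ i ∈ F, ‖a i‖ ≤ d i * ρ i)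
    (hB : ∀ ν s, ∑ j ∈ F with η j = ν, Real.exp (-((s - ω j) ^ 2 / 4)) * ρ j ^ 2 ≤ B) :
    eLpNorm (waveSum F a ω η) 2 (slabMeasure k (Set.Icc 0 1)) ≤
      ENNReal.ofReal (Real.sqrt (Real.exp 1 * Real.sqrt π * B) *
        (Real.sqrt (mass k) * Real.sqrt (∑ i ∈ F, d i ^ 2))) := by
  have h0 : 0 ≤ ∑ i ∈ F, d i ^ 2 := by positivity
  have hm := mass_pos k
  rw [← ENNReal.pow_le_pow_left_iff two_ne_zero, sq_eLpNorm_two,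
    ← ENNReal.ofReal_pow (by positivity)]
  refine (lintegral_enorm_waveSum_sq_le F a ω η).trans (ENNReal.ofReal_le_ofReal ?_)
  rw [mul_pow, mul_pow, Real.sq_sqrt (by positivity), Real.sq_sqrt hm.le, Real.sq_sqrt h0]
  have h1 := sum_sum_le_of_schur F η ω (d := d) (ρ := ρ) (B := B)
    (K := fun s => Real.exp (-(s ^ 2 / 4))) (fun s => (Real.exp_pos _).le) (fun s => by simp) hB
  have h2 : (∑ i ∈ F, ∑ j ∈ F,
      if η i = η j then ‖a i‖ * ‖a j‖ * Real.exp (-((ω i - ω j) ^ 2 / 4)) else 0) ≤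
      B * ∑ i ∈ F, d i ^ 2 := by
    refine le_trans (Finset.sum_le_sum fun i hi => Finset.sum_le_sum fun j hj => ?_) h1
    split_ifs
    · have := ha i hi
      have := ha j hj
      have := (norm_nonneg (a i)).trans (ha i hi)
      gcongr
    · exact le_rfl
  calc _ ≤ Real.exp 1 * Real.sqrt π * mass k * (B * ∑ i ∈ F, d i ^ 2) := by gcongr
    _ = _ := by ring

/-! ### Frequencies of the traces -/

/-- The frequency in `Λ^k × Λ^k` of the trace `γ(x, x_j; x', x_j)` of the mode `ζ`. -/
def traceFreq {k : ℕ} (j : Fin k) (ζ : Freq (k + 1)) : Freq k :=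
  (Function.update (fun i => ζ.1 i.castSucc) j
    (ζ.1 j.castSucc + ζ.1 (Fin.last k) - ζ.2 (Fin.last k)), fun i => ζ.2 i.castSucc)

theorem sobolevWeight_swap {k : ℕ} (α : ℝ) (ζ : Freq k) :
    sobolevWeight α ζ.swap = sobolevWeight α ζ := mul_comm _ _

theorem energy_swap {k : ℕ} (θ : Fin 2 → ℝ) (ζ : Freq k) : energy θ ζ.swap = -energy θ ζ := by
  simp [energy]

theorem one_le_sobolevWeight {k : ℕ} {α : ℝ} (hα : 0 ≤ α) (ζ : Freq k) :
    1 ≤ sobolevWeight α ζ := by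
  have h : ∀ ξ : Fin k → Lattice, 1 ≤ ∏ j, japaneseBracket (ξ j) ^ α := fun ξ =>
    Finset.prod_induction _ (1 ≤ ·) (fun _ _ => one_le_mul_of_one_le_of_one_le) le_rfl
      fun j _ => Real.one_le_rpow (one_le_japaneseBracket _) hα
  exact one_le_mul_of_one_le_of_one_le (h _) (h _)

theorem sobolevWeight_pos {k : ℕ} (α : ℝ) (ζ : Freq k) : 0 < sobolevWeight α ζ := by
  have h : ∀ ξ : Fin k → Lattice, 0 < ∏ j, japaneseBracket (ξ j) ^ α := fun ξ =>
    Finset.prod_pos fun j _ => Real.rpow_pos_of_pos (japaneseBracket_pos _) _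
  exact mul_pos (h _) (h _)

/-- The resonance identity: the interaction changes the energy by a bilinear form in the shifts. -/
theorem quadForm_interaction (θ : Fin 2 → ℝ) (ξ u v : Lattice) :
    quadForm θ (ξ + u) + quadForm θ (ξ + v) - quadForm θ (ξ + u + v) - quadForm θ ξ =
      -(2 * θ 0 ^ 2 * (u 0 * v 0 : ℤ) + 2 * θ 1 ^ 2 * (u 1 * v 1 : ℤ)) := by
  simp only [quadForm, Fin.sum_univ_two, Pi.add_apply]
  push_cast
  ring

/-- Changing one factor of a finite product; `P` is the product of the other factors. -/
@[to_additive]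
theorem exists_prod_update {ι A M : Type*} [Fintype ι] [DecidableEq ι] [CommMonoid M]
    (f : ι → A → M) (g : ι → A) (j : ι) (x : A) :
    ∃ P, ∏ i, f i (g i) = f j (g j) * P ∧ ∏ i, f i (Function.update g j x i) = f j x * P := by
  refine ⟨∏ i ∈ Finset.univ.erase j, f i (g i), (Finset.mul_prod_erase _ _ (Finset.mem_univ j)).symm,
    ?_⟩
  rw [← Finset.mul_prod_erase _ _ (Finset.mem_univ j), Function.update_self]
  congr 1
  refine Finset.prod_congr rfl fun i hi => ?_
  rw [Function.update_of_ne (Finset.ne_of_mem_erase hi)]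

theorem energy_eq_traceFreq {k : ℕ} (θ : Fin 2 → ℝ) (j : Fin k) (ζ : Freq (k + 1)) :
    energy θ ζ = energy θ (traceFreq j ζ) + (quadForm θ (ζ.1 j.castSucc) +
      quadForm θ (ζ.1 (Fin.last k)) - quadForm θ (ζ.2 (Fin.last k)) -
      quadForm θ ((traceFreq j ζ).1 j)) := by
  obtain ⟨P, h1, h2⟩ := exists_sum_update (fun _ => quadForm θ) (fun i : Fin k => ζ.1 i.castSucc) j
    (ζ.1 j.castSucc + ζ.1 (Fin.last k) - ζ.2 (Fin.last k))
  simp only [energy, traceFreq, Fin.sum_univ_castSucc, Function.update_self, h1, h2]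
  ring

theorem sobolevWeight_eq_traceFreq {k : ℕ} (α : ℝ) (j : Fin k) (ζ : Freq (k + 1)) :
    sobolevWeight α ζ * japaneseBracket ((traceFreq j ζ).1 j) ^ α =
      sobolevWeight α (traceFreq j ζ) * (japaneseBracket (ζ.1 j.castSucc) ^ α *
      japaneseBracket (ζ.1 (Fin.last k)) ^ α * japaneseBracket (ζ.2 (Fin.last k)) ^ α) := by
  obtain ⟨P, h1, h2⟩ := exists_prod_update (fun _ ξ => japaneseBracket ξ ^ α)
    (fun i : Fin k => ζ.1 i.castSucc) j (ζ.1 j.castSucc + ζ.1 (Fin.last k) - ζ.2 (Fin.last k))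
  simp only [sobolevWeight, traceFreq, Fin.prod_univ_castSucc, Function.update_self, h1, h2]
  ring

/-- The shifts `(u, v)` with `ζ_j = η_j + u` and `ζ_{k+1} = η_j + v`, where `η` is the frequency of
the trace of `ζ`. -/
def traceShift {k : ℕ} (j : Fin k) (ζ : Freq (k + 1)) : Lattice × Lattice :=
  (ζ.1 j.castSucc - (traceFreq j ζ).1 j, ζ.1 (Fin.last k) - (traceFreq j ζ).1 j)

theorem add_traceShift_fst {k : ℕ} (j : Fin k) (ζ : Freq (k + 1)) :
    (traceFreq j ζ).1 j + (traceShift j ζ).1 = ζ.1 j.castSucc := add_sub_cancel _ _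

theorem add_traceShift_snd {k : ℕ} (j : Fin k) (ζ : Freq (k + 1)) :
    (traceFreq j ζ).1 j + (traceShift j ζ).2 = ζ.1 (Fin.last k) := add_sub_cancel _ _

theorem add_traceShift_add {k : ℕ} (j : Fin k) (ζ : Freq (k + 1)) :
    (traceFreq j ζ).1 j + (traceShift j ζ).1 + (traceShift j ζ).2 = ζ.2 (Fin.last k) := by
  simp only [traceShift, traceFreq, Function.update_self]
  abel

theorem traceShift_injOn {k : ℕ} (j : Fin k) (η : Freq k) :
    Set.InjOn (traceShift j) {ζ | traceFreq j ζ = η} := by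
  intro ζ hζ ζ' hζ' h
  have e : traceFreq j ζ = traceFreq j ζ' := hζ.trans hζ'.symm
  have h1 : ζ.1 j.castSucc = ζ'.1 j.castSucc := by
    rw [← add_traceShift_fst, e, h, add_traceShift_fst]
  have h2 : ζ.1 (Fin.last k) = ζ'.1 (Fin.last k) := by
    rw [← add_traceShift_snd j, e, h, add_traceShift_snd]
  have h3 : ζ.2 (Fin.last k) = ζ'.2 (Fin.last k) := by
    rw [← add_traceShift_add j, e, h, add_traceShift_add]
  refine Prod.ext ?_ ?_
  · funext i
    induction i using Fin.lastCases with
    | last => exact h2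
    | cast i =>
      by_cases hi : i = j
      · rw [hi, h1]
      · have := congrFun (congrArg Prod.fst e) i
        simpa [traceFreq, hi] using this
  · funext i
    induction i using Fin.lastCases with
    | last => exact h3
    | cast i => exact congrFun (congrArg Prod.snd e) i

/-- All factors of the Sobolev weights except those of the four interacting frequencies cancel, which
is why the estimate does not depend on `k`. -/
theorem sq_sobolevWeight_div_eq {k : ℕ} (α : ℝ) (j : Fin k) (ζ : Freq (k + 1)) :
    (sobolevWeight α (traceFreq j ζ) / sobolevWeight α ζ) ^ 2 =
      interactionWeight α ((traceFreq j ζ).1 j) (traceShift j ζ).1 (traceShift j ζ).2 := by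
  have h0 := japaneseBracket_pos ((traceFreq j ζ).1 j)
  have h1 := japaneseBracket_pos (ζ.1 j.castSucc)
  have h2 := japaneseBracket_pos (ζ.1 (Fin.last k))
  have h3 := japaneseBracket_pos (ζ.2 (Fin.last k))
  rw [interactionWeight, add_traceShift_add, add_traceShift_fst, add_traceShift_snd]
  have e : sobolevWeight α (traceFreq j ζ) / sobolevWeight α ζ =
      (japaneseBracket ((traceFreq j ζ).1 j) / (japaneseBracket (ζ.1 j.castSucc) *
        japaneseBracket (ζ.1 (Fin.last k)) * japaneseBracket (ζ.2 (Fin.last k)))) ^ α := by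
    rw [Real.div_rpow h0.le (by positivity), Real.mul_rpow (by positivity) h3.le,
      Real.mul_rpow h1.le h2.le, div_eq_div_iff (sobolevWeight_pos _ _).ne' (by positivity),
      ← sobolevWeight_eq_traceFreq, mul_comm]
  rw [e, ← Real.rpow_natCast, ← Real.rpow_mul (by positivity)]
  congr 1
  push_cast
  ring

/-- The quantity controlled by the Schur test: a sum over the modes whose trace has a given
frequency. -/
theorem exists_sum_fiber_le {α : ℝ} (hα : 1 / 2 < α) {θ : Fin 2 → ℝ} (hθ : ∀ i, 0 < θ i) :
    ∃ B : ℝ, 0 < B ∧ ∀ (k : ℕ) (j : Fin k) (F : Finset (Freq (k + 1))) (ν : Freq k) (s : ℝ),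
      ∑ ζ ∈ F with traceFreq j ζ = ν, Real.exp (-((s - energy θ ζ) ^ 2 / 4)) *
        (sobolevWeight α (traceFreq j ζ) / sobolevWeight α ζ) ^ 2 ≤ B := by
  let κ : Fin 2 → ℝ := fun i => 2 * θ i ^ 2
  have hκ : ∀ i, 0 < κ i := fun i => by have := hθ i; positivity
  obtain ⟨C, hC, h⟩ := exists_tsum_interactionWeight_le (κ₀ := min (κ 0) (κ 1)) hα
    (lt_min (hκ 0) (hκ 1))
  refine ⟨C.toReal + 1, by positivity, fun k j F ν s => ?_⟩
  have hκ' : ∀ i, min (κ 0) (κ 1) ≤ |κ i| := by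
    intro i
    rw [abs_of_pos (hκ i)]
    fin_cases i
    · exact min_le_left _ _
    · exact min_le_right _ _
  have hC' := h (ν.1 j) κ (s - energy θ ν) hκ'
  suffices hsum : ENNReal.ofReal (∑ ζ ∈ F with traceFreq j ζ = ν,
      Real.exp (-((s - energy θ ζ) ^ 2 / 4)) *
        (sobolevWeight α (traceFreq j ζ) / sobolevWeight α ζ) ^ 2) ≤ C by
    have := (ENNReal.ofReal_le_iff_le_toReal hC).mp hsum
    linarith
  rw [ENNReal.ofReal_sum_of_nonneg fun _ _ => by positivity]
  refine le_trans ?_ hC'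
  refine le_trans ?_ (ENNReal.sum_le_tsum
    ((F.filter fun ζ => traceFreq j ζ = ν).image (traceShift j)))
  rw [Finset.sum_image fun ζ hζ ζ' hζ' => traceShift_injOn j ν (by simpa using (Finset.mem_filter.mp hζ).2)
    (by simpa using (Finset.mem_filter.mp hζ').2)]
  refine Finset.sum_le_sum fun ζ hζ => le_of_eq ?_
  have hν : traceFreq j ζ = ν := (Finset.mem_filter.mp hζ).2
  rw [sq_sobolevWeight_div_eq, hν, mul_comm, ENNReal.ofReal_mul (interactionWeight_nonneg _ _ _ _)]
  congr 1
  rw [gaussKernel]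
  congr 5
  rw [energy_eq_traceFreq θ j ζ]
  have hq := quadForm_interaction θ ((traceFreq j ζ).1 j) (traceShift j ζ).1 (traceShift j ζ).2
  rw [add_traceShift_add, add_traceShift_fst, add_traceShift_snd] at hq
  rw [hq, hν]
  simp only [κ]
  ring

/-- The analogue for the trace `γ(x, x'_j; x', x'_j)`, which is the trace at `x_j` after exchanging
the primed and unprimed variables. -/
theorem exists_sum_fiber_swap_le {α : ℝ} (hα : 1 / 2 < α) {θ : Fin 2 → ℝ} (hθ : ∀ i, 0 < θ i) :
    ∃ B : ℝ, 0 < B ∧ ∀ (k : ℕ) (j : Fin k) (F : Finset (Freq (k + 1))) (ν : Freq k) (s : ℝ),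
      ∑ ζ ∈ F with (traceFreq j ζ.swap).swap = ν, Real.exp (-((s - energy θ ζ) ^ 2 / 4)) *
        (sobolevWeight α (traceFreq j ζ.swap).swap / sobolevWeight α ζ) ^ 2 ≤ B := by
  obtain ⟨B, hB, h⟩ := exists_sum_fiber_le hα hθ
  refine ⟨B, hB, fun k j F ν s => le_of_eq_of_le ?_
    (h k j (F.map (Equiv.prodComm _ _).toEmbedding) ν.swap (-s))⟩
  rw [Finset.filter_map, Finset.sum_map]
  refine Finset.sum_congr ?_ fun ζ _ => ?_
  · ext ζ
    simp only [Finset.mem_filter, Function.comp_apply, Equiv.coe_toEmbedding, Equiv.prodComm_apply]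
    rw [← Prod.swap_inj, Prod.swap_swap]
  · simp only [Equiv.coe_toEmbedding, Equiv.prodComm_apply, energy_swap, sobolevWeight_swap]
    congr 3
    ring

/-- The trace at `x_j` of a character is a character. -/
theorem collision_character {k : ℕ} (j : Fin k) (ζ : Freq (k + 1)) (p : Space k) :
    character (k + 1) ζ (Fin.snoc (α := fun _ => Torus) p.1 (p.1 j),
      Fin.snoc (α := fun _ => Torus) p.2 (p.1 j)) = character k (traceFreq j ζ) p := by
  obtain ⟨P, h1, h2⟩ := exists_prod_update (fun a ξ => ∏ i, (fourier (ξ i) (p.1 a i) : ℂ))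
    (fun i : Fin k => ζ.1 i.castSucc) j (ζ.1 j.castSucc + ζ.1 (Fin.last k) - ζ.2 (Fin.last k))
  simp only [character, ContinuousMap.coe_mk, traceFreq, Fin.prod_univ_castSucc (n := k),
    Fin.snoc_castSucc, Fin.snoc_last, h1, h2]
  have e : ∏ i, (fourier ((ζ.1 j.castSucc + ζ.1 (Fin.last k) - ζ.2 (Fin.last k)) i) (p.1 j i) : ℂ) =
      (∏ i, fourier (ζ.1 j.castSucc i) (p.1 j i)) * (∏ i, fourier (ζ.1 (Fin.last k) i) (p.1 j i)) *
        ∏ i, fourier (-ζ.2 (Fin.last k) i) (p.1 j i) := by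
    simp only [Pi.sub_apply, Pi.add_apply, sub_eq_add_neg, fourier_add, Finset.prod_mul_distrib]
  rw [e]
  ring

theorem character_swap {k : ℕ} (ζ : Freq k) (p : Space k) :
    character k ζ.swap p.swap = (starRingEnd ℂ) (character k ζ p) := by
  simp only [character, ContinuousMap.coe_mk, map_mul, map_prod, ← fourier_neg, Prod.fst_swap,
    Prod.snd_swap, neg_neg]
  rw [mul_comm]

theorem collision_character_swap {k : ℕ} (j : Fin k) (ζ : Freq (k + 1)) (p : Space k) :
    character (k + 1) ζ (Fin.snoc (α := fun _ => Torus) p.1 (p.2 j),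
      Fin.snoc (α := fun _ => Torus) p.2 (p.2 j)) = character k (traceFreq j ζ.swap).swap p := by
  have h := collision_character j ζ.swap p.swap
  apply (starRingEnd ℂ).injective
  rw [← character_swap, ← character_swap]
  simpa using h

/-! ### Limits in `L²` and Fourier coefficients of time slices -/

instance isFiniteMeasure_slabMeasure (k : ℕ) :
    IsFiniteMeasure (slabMeasure k (Set.Icc 0 1)) := by
  unfold slabMeasure; infer_instance

theorem memLp_of_continuous_of_bound {k : ℕ} {f : ℝ × Space k → ℂ} (hf : Continuous f) {C : ℝ}
    (hC : ∀ q, ‖f q‖ ≤ C) : MemLp f 2 (slabMeasure k (Set.Icc 0 1)) :=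
  MemLp.of_bound hf.measurable.aestronglyMeasurable C (Eventually.of_forall hC)

/-- Unconditional convergence of a series in `L²` whose finite partial sums are bounded by the
`ℓ²` norm of the corresponding coefficients. -/
theorem exists_tendsto_eLpNorm_sum {ι X : Type*} [MeasurableSpace X] {μ : Measure X}
    {f : ι → X → ℂ} (hf : ∀ i, MemLp (f i) 2 μ) {d : ι → ℝ} (hd : Summable fun i => d i ^ 2)
    {M : ℝ} (hM : 0 ≤ M)
    (h : ∀ F : Finset ι, eLpNorm (fun x => ∑ i ∈ F, f i x) 2 μ ≤
      ENNReal.ofReal (M * Real.sqrt (∑ i ∈ F, d i ^ 2))) :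
    ∃ H : X → ℂ, MemLp H 2 μ ∧
      Tendsto (fun F : Finset ι => eLpNorm (fun x => ∑ i ∈ F, f i x - H x) 2 μ) atTop (𝓝 0) ∧
      eLpNorm H 2 μ ≤ ENNReal.ofReal (M * Real.sqrt (∑' i, d i ^ 2)) := by
  classical
  set x : ι → Lp ℂ 2 μ := fun i => (hf i).toLp (f i) with hx
  have hcoe : ∀ F : Finset ι, ⇑(∑ i ∈ F, x i) =ᵐ[μ] fun y => ∑ i ∈ F, f i y := by
    intro F
    induction F using Finset.induction_on with
    | empty => simp only [Finset.sum_empty]; exact Lp.coeFn_zero ℂ 2 μ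
    | insert i F hi ih =>
      rw [Finset.sum_insert hi]
      filter_upwards [Lp.coeFn_add (x i) (∑ i ∈ F, x i), ih, (hf i).coeFn_toLp] with y h1 h2 h3
      rw [h1, Pi.add_apply, h2, h3, Finset.sum_insert hi]
  have hnorm : ∀ F : Finset ι, ‖∑ i ∈ F, x i‖ ≤ M * Real.sqrt (∑ i ∈ F, d i ^ 2) := by
    intro F
    rw [Lp.norm_def, eLpNorm_congr_ae (hcoe F)]
    exact ENNReal.toReal_le_of_le_ofReal (by positivity) (h F)
  have hsum : Summable x := by
    rw [summable_iff_vanishing_norm]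
    intro ε hε
    obtain ⟨s, hs⟩ := summable_iff_vanishing_norm.mp hd ((ε / (M + 1)) ^ 2) (by positivity)
    refine ⟨s, fun t ht => (hnorm t).trans_lt ?_⟩
    have h1 := hs t ht
    rw [Real.norm_of_nonneg (by positivity)] at h1
    have h2 : Real.sqrt (∑ i ∈ t, d i ^ 2) < ε / (M + 1) :=
      (Real.sqrt_lt' (by positivity)).mpr h1
    calc M * Real.sqrt (∑ i ∈ t, d i ^ 2) ≤ (M + 1) * Real.sqrt (∑ i ∈ t, d i ^ 2) := by
          gcongr; linarith
      _ < (M + 1) * (ε / (M + 1)) := by gcongr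
      _ = ε := by field_simp
  refine ⟨⇑(∑' i, x i), Lp.memLp _, ?_, ?_⟩
  · have h1 : Tendsto (fun F : Finset ι => ‖∑ i ∈ F, x i - ∑' i, x i‖ₑ) atTop (𝓝 0) := by
      have := (tendsto_iff_norm_sub_tendsto_zero.mp hsum.hasSum)
      simpa [← ofReal_norm] using ENNReal.tendsto_ofReal this
    refine h1.congr fun F => ?_
    rw [Lp.enorm_def]
    refine eLpNorm_congr_ae ?_
    filter_upwards [Lp.coeFn_sub (∑ i ∈ F, x i) (∑' i, x i), hcoe F] with y h2 h3
    rw [h2, Pi.sub_apply, h3]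
  · have h1 : ‖∑' i, x i‖ ≤ M * Real.sqrt (∑' i, d i ^ 2) := by
      refine le_of_tendsto hsum.hasSum.norm (Eventually.of_forall fun F => (hnorm F).trans ?_)
      gcongr
      exact hd.sum_le_tsum F fun _ _ => by positivity
    rw [← Lp.enorm_def, ← ofReal_norm]
    exact ENNReal.ofReal_le_ofReal h1

theorem ae_memLp_slice {k : ℕ} {u : ℝ × Space k → ℂ} {I : Set ℝ}
    (hu : MemLp u 2 (slabMeasure k I)) :
    ∀ᵐ t ∂(volume.restrict I), MemLp (fun p => u (t, p)) 2 volume := by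
  have hfin : ∫⁻ t in I, ∫⁻ p, ‖u (t, p)‖ₑ ^ 2 < ⊤ := by
    have h1 : ∫⁻ q, ‖u q‖ₑ ^ 2 ∂(slabMeasure k I) < ⊤ := by
      rw [← sq_eLpNorm_two]
      exact ENNReal.pow_lt_top hu.2
    rwa [slabMeasure, lintegral_prod _ (hu.1.enorm.pow_const 2)] at h1
  have hm : AEMeasurable (fun t => ∫⁻ p, ‖u (t, p)‖ₑ ^ 2) (volume.restrict I) :=
    AEMeasurable.lintegral_prod_right' (f := fun q => ‖u q‖ₑ ^ 2) (hu.1.enorm.pow_const 2)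
  filter_upwards [ae_lt_top' hm hfin.ne, hu.1.prodMk_left] with t h1 h2
  refine ⟨h2, ?_⟩
  rw [← sq_eLpNorm_two] at h1
  by_contra h
  rw [not_lt_top_iff] at h
  simp [h] at h1

/-- The Fourier coefficient of the time slices is a bounded map from `L²` in space-time to `L¹` in
time. -/
theorem lintegral_fourierTransform_le {k : ℕ} {u : ℝ × Space k → ℂ}
    (hu : AEStronglyMeasurable u (slabMeasure k (Set.Icc 0 1))) (η : Freq k) :
    ∫⁻ t in Set.Icc (0 : ℝ) 1, ‖fourierTransform (fun p => u (t, p)) η‖ₑ ≤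
      eLpNorm u 2 (slabMeasure k (Set.Icc 0 1)) *
        slabMeasure k (Set.Icc 0 1) Set.univ ^ (1 / 2 : ℝ) := by
  calc _ ≤ ∫⁻ t in Set.Icc (0 : ℝ) 1, ∫⁻ p, ‖u (t, p)‖ₑ := by
        refine lintegral_mono fun t => (enorm_integral_le_lintegral_enorm _).trans (le_of_eq ?_)
        refine lintegral_congr fun p => ?_
        rw [← ofReal_norm, norm_mul, RCLike.norm_conj, norm_character, mul_one, ofReal_norm]
    _ = ∫⁻ q, ‖u q‖ₑ ∂(slabMeasure k (Set.Icc 0 1)) := by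
        rw [slabMeasure, lintegral_prod _ hu.enorm]
    _ = eLpNorm u 1 (slabMeasure k (Set.Icc 0 1)) := eLpNorm_one_eq_lintegral_enorm.symm
    _ ≤ _ := by
        refine (eLpNorm_le_eLpNorm_mul_rpow_measure_univ (p := 1) (q := 2) (by norm_num) hu).trans
          (le_of_eq ?_)
        norm_num

theorem integrable_mul_conj_character {k : ℕ} {f : DensityMatrix k} (hf : Integrable f volume)
    (η : Freq k) : Integrable (fun p => f p * (starRingEnd ℂ) (character k η p)) volume := by
  refine hf.mul_bdd (c := 1) ?_ (Eventually.of_forall fun p => ?_)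
  · exact Continuous.aestronglyMeasurable (by fun_prop)
  · rw [RCLike.norm_conj, norm_character]

theorem fourierTransform_sub {k : ℕ} {f g : DensityMatrix k} (hf : Integrable f volume)
    (hg : Integrable g volume) (η : Freq k) :
    fourierTransform (fun p => f p - g p) η = fourierTransform f η - fourierTransform g η := by
  simp only [fourierTransform, sub_mul]
  exact integral_sub (integrable_mul_conj_character hf η) (integrable_mul_conj_character hg η)

theorem fourierTransform_const_mul {k : ℕ} (c : ℂ) (f : DensityMatrix k) (η : Freq k) :
    fourierTransform (fun p => c * f p) η = c * fourierTransform f η := by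
  simp only [fourierTransform, mul_assoc]
  exact integral_const_mul _ _

theorem fourierTransform_waveSum {ι : Type*} {k : ℕ} (F : Finset ι) (a : ι → ℂ) (ω : ι → ℝ)
    (ν : ι → Freq k) (t : ℝ) (η : Freq k) :
    fourierTransform (fun p => waveSum F a ω ν (t, p)) η =
      ∑ i ∈ F, a i * phase t (ω i) * (if ν i = η then (mass k : ℂ) else 0) := by
  simp only [fourierTransform, waveSum, Finset.sum_mul, mul_assoc]
  rw [integral_finsetSum]
  · refine Finset.sum_congr rfl fun i _ => ?_
    rw [integral_const_mul, integral_const_mul, integral_character_mul_conj]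
  · exact fun i _ => integrable_of_continuous (by fun_prop)

/-- Multiplication of Fourier coefficients by a fixed factor passes to `L²` limits of
time-dependent density matrices, for almost every time. -/
theorem ae_fourierTransform_eq_of_tendsto {ι : Type*} {l : Filter ι} [l.NeBot] {k : ℕ}
    {G H : ℝ × Space k → ℂ} {u v : ι → ℝ × Space k → ℂ}
    (hG : MemLp G 2 (slabMeasure k (Set.Icc 0 1))) (hH : MemLp H 2 (slabMeasure k (Set.Icc 0 1)))
    (hu : ∀ i, Continuous (u i)) (hv : ∀ i, Continuous (v i))
    (huG : Tendsto (fun i => eLpNorm (fun q => u i q - G q) 2 (slabMeasure k (Set.Icc 0 1))) l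
      (𝓝 0))
    (hvH : Tendsto (fun i => eLpNorm (fun q => v i q - H q) 2 (slabMeasure k (Set.Icc 0 1))) l
      (𝓝 0))
    (η : Freq k) (c : ℂ)
    (h : ∀ i t, fourierTransform (fun p => u i (t, p)) η =
      c * fourierTransform (fun p => v i (t, p)) η) :
    ∀ᵐ t ∂(volume.restrict (Set.Icc (0 : ℝ) 1)),
      fourierTransform (fun p => G (t, p)) η = c * fourierTransform (fun p => H (t, p)) η := by
  set μ := slabMeasure k (Set.Icc 0 1) with hμ
  set Δ : ℝ → ℂ := fun t =>
    fourierTransform (fun p => G (t, p)) η - c * fourierTransform (fun p => H (t, p)) η with hΔ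
  have hmeasFT : ∀ w : ℝ × Space k → ℂ, AEStronglyMeasurable w μ →
      AEStronglyMeasurable (fun t => fourierTransform (fun p => w (t, p)) η)
        (volume.restrict (Set.Icc (0 : ℝ) 1)) := by
    intro w hw
    refine AEStronglyMeasurable.integral_prod_right' (f := fun q : ℝ × Space k =>
      w q * (starRingEnd ℂ) (character k η q.2)) (hw.mul ?_)
    have : Continuous fun q : ℝ × Space k => (starRingEnd ℂ) (character k η q.2) := by fun_prop
    exact this.measurable.aestronglyMeasurable
  have hmeas : AEStronglyMeasurable Δ (volume.restrict (Set.Icc (0 : ℝ) 1)) :=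
    (hmeasFT G hG.1).sub ((hmeasFT H hH.1).const_mul c)
  have hslice : ∀ w : ℝ × Space k → ℂ, Continuous w → ∀ t, Integrable (fun p => w (t, p)) volume :=
    fun w hw t => integrable_of_continuous (by fun_prop)
  have hbound : ∀ i, ∫⁻ t in Set.Icc (0 : ℝ) 1, ‖Δ t‖ₑ ≤
      (eLpNorm (fun q => u i q - G q) 2 μ + ‖c‖ₑ * eLpNorm (fun q => v i q - H q) 2 μ) *
        μ Set.univ ^ (1 / 2 : ℝ) := by
    intro i
    have hum : AEStronglyMeasurable (fun q => u i q - G q) μ :=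
      ((hu i).measurable.aestronglyMeasurable).sub hG.1
    have hvm : AEStronglyMeasurable (fun q => v i q - H q) μ :=
      ((hv i).measurable.aestronglyMeasurable).sub hH.1
    set w : ℝ × Space k → ℂ := fun q => (u i q - G q) - c * (v i q - H q) with hw
    have hwm : AEStronglyMeasurable w μ := hum.sub (hvm.const_mul c)
    have h1 : ∫⁻ t in Set.Icc (0 : ℝ) 1, ‖Δ t‖ₑ =
        ∫⁻ t in Set.Icc (0 : ℝ) 1, ‖fourierTransform (fun p => w (t, p)) η‖ₑ := by
      refine lintegral_congr_ae ?_
      filter_upwards [ae_memLp_slice hG, ae_memLp_slice hH] with t hGt hHt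
      have iG := hGt.integrable (by norm_num)
      have iH := hHt.integrable (by norm_num)
      have iu := hslice _ (hu i) t
      have iv := hslice _ (hv i) t
      simp only [hw, hΔ]
      rw [fourierTransform_sub (f := fun p => u i (t, p) - G (t, p))
          (g := fun p => c * (v i (t, p) - H (t, p))) (iu.sub iG) ((iv.sub iH).const_mul c),
        fourierTransform_const_mul,
        fourierTransform_sub iu iG, fourierTransform_sub iv iH, h i t, ← enorm_neg]
      congr 1
      ring
    rw [h1]
    refine (lintegral_fourierTransform_le hwm η).trans ?_
    gcongr
    refine (eLpNorm_sub_le hum (hvm.const_mul c) (by norm_num)).trans ?_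
    gcongr
    exact le_of_eq (eLpNorm_const_smul c _ _ _)
  have hlim : Tendsto (fun i => (eLpNorm (fun q => u i q - G q) 2 μ +
      ‖c‖ₑ * eLpNorm (fun q => v i q - H q) 2 μ) * μ Set.univ ^ (1 / 2 : ℝ)) l (𝓝 0) := by
    have hfin : μ Set.univ ^ (1 / 2 : ℝ) ≠ ⊤ :=
      ENNReal.rpow_ne_top_of_nonneg (by norm_num) (measure_ne_top _ _)
    have h1 := ENNReal.Tendsto.mul_const
      (huG.add (ENNReal.Tendsto.const_mul hvH (Or.inr (enorm_ne_top (x := c))))) (Or.inr hfin)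
    simpa using h1
  have hzero : ∫⁻ t in Set.Icc (0 : ℝ) 1, ‖Δ t‖ₑ = 0 :=
    le_antisymm (ge_of_tendsto' hlim hbound) bot_le
  rw [lintegral_eq_zero_iff' hmeas.enorm] at hzero
  filter_upwards [hzero] with t ht
  simpa [hΔ, sub_eq_zero] using ht

/-! ### The spacetime estimate -/

theorem waveSum_sub_singleton_sum {ι : Type*} {k : ℕ} (F : Finset ι) (a b : ι → ℂ) (ω : ι → ℝ)
    (ν ν' : ι → Freq k) (q : ℝ × Space k) :
    ∑ i ∈ F, (waveSum {i} a ω ν q - waveSum {i} b ω ν' q) =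
      waveSum F a ω ν q - waveSum F b ω ν' q := by
  simp only [waveSum, Finset.sum_singleton, Finset.sum_sub_distrib]

/-- The collision of the truncated free evolution of `γ`, with the Fourier coefficients of the
result multiplied by `m`. -/
noncomputable def collisionSum {k : ℕ} (θ : Fin 2 → ℝ) (j : Fin k) (γ : DensityMatrix (k + 1))
    (m : Freq k → ℝ) (F : Finset (Freq (k + 1))) (q : ℝ × Space k) : ℂ :=
  waveSum F (fun ζ => inversionConst (k + 1) * fourierTransform γ ζ * m (traceFreq j ζ))
      (energy θ) (traceFreq j) q -
    waveSum F
      (fun ζ => inversionConst (k + 1) * fourierTransform γ ζ * m (traceFreq j ζ.swap).swap)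
      (energy θ) (fun ζ => (traceFreq j ζ.swap).swap) q

theorem continuous_collisionSum {k : ℕ} (θ : Fin 2 → ℝ) (j : Fin k) (γ : DensityMatrix (k + 1))
    (m : Freq k → ℝ) (F : Finset (Freq (k + 1))) : Continuous (collisionSum θ j γ m F) :=
  (continuous_waveSum _ _ _ _).sub (continuous_waveSum _ _ _ _)

theorem norm_waveSum_le {ι : Type*} {k : ℕ} (F : Finset ι) (a : ι → ℂ) (ω : ι → ℝ)
    (ν : ι → Freq k) (q : ℝ × Space k) : ‖waveSum F a ω ν q‖ ≤ ∑ i ∈ F, ‖a i‖ :=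
  (norm_sum_le _ _).trans (le_of_eq (Finset.sum_congr rfl fun i _ => by
    rw [norm_mul, norm_mul, norm_phase, norm_character, mul_one, mul_one]))

theorem memLp_collisionSum {k : ℕ} (θ : Fin 2 → ℝ) (j : Fin k) (γ : DensityMatrix (k + 1))
    (m : Freq k → ℝ) (F : Finset (Freq (k + 1))) :
    MemLp (collisionSum θ j γ m F) 2 (slabMeasure k (Set.Icc 0 1)) :=
  memLp_of_continuous_of_bound (continuous_collisionSum θ j γ m F) fun _ =>
    (norm_sub_le _ _).trans (add_le_add (norm_waveSum_le _ _ _ _ _) (norm_waveSum_le _ _ _ _ _))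

theorem sum_collisionSum_singleton {k : ℕ} (θ : Fin 2 → ℝ) (j : Fin k) (γ : DensityMatrix (k + 1))
    (m : Freq k → ℝ) (F : Finset (Freq (k + 1))) (q : ℝ × Space k) :
    ∑ ζ ∈ F, collisionSum θ j γ m {ζ} q = collisionSum θ j γ m F q :=
  waveSum_sub_singleton_sum _ _ _ _ _ _ _

theorem collision_partialSum_freeEvolution {k : ℕ} (θ : Fin 2 → ℝ) (j : Fin k)
    {γ : DensityMatrix (k + 1)} (hγ : MemLp γ 2 volume) (F : Finset (Freq (k + 1)))
    (q : ℝ × Space k) :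
    collision j (partialSum F (⇑(freeEvolution θ q.1 γ))) q.2 = collisionSum θ j γ 1 F q := by
  simp only [collision, partialSum, collision_character, collision_character_swap, collisionSum,
    waveSum, Finset.mul_sum, ← mul_assoc, fourierTransform_freeEvolution θ q.1 hγ]
  congr 1 <;> refine Finset.sum_congr rfl fun ζ _ => ?_ <;>
    simp only [Pi.one_apply, Complex.ofReal_one, mul_one] <;> ring

theorem fourierTransform_collisionSum {k : ℕ} (θ : Fin 2 → ℝ) (j : Fin k)
    (γ : DensityMatrix (k + 1)) (m : Freq k → ℝ) (F : Finset (Freq (k + 1))) (t : ℝ) (η : Freq k) :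
    fourierTransform (fun p => collisionSum θ j γ m F (t, p)) η =
      m η * fourierTransform (fun p => collisionSum θ j γ 1 F (t, p)) η := by
  have hint : ∀ (a : Freq (k + 1) → ℂ) (ν : Freq (k + 1) → Freq k),
      Integrable (fun p => waveSum F a (energy θ) ν (t, p)) volume := fun a ν => by
    have := continuous_waveSum F a (energy θ) ν
    exact integrable_of_continuous (by fun_prop)
  simp only [collisionSum]
  rw [fourierTransform_sub (hint _ _) (hint _ _), fourierTransform_sub (hint _ _) (hint _ _),
    mul_sub]
  simp only [fourierTransform_waveSum, Finset.mul_sum]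
  congr 1 <;> refine Finset.sum_congr rfl fun ζ _ => ?_ <;> split_ifs with h
  · rw [h]; simp; ring
  · simp
  · rw [h]; simp; ring
  · simp

/-- The spacetime estimate for finite sets of modes, with a constant that depends neither on the
set of modes nor on `k`. -/
theorem exists_eLpNorm_collisionSum_le {α : ℝ} (hα : 1 / 2 < α) {θ : Fin 2 → ℝ}
    (hθ : ∀ i, 0 < θ i) :
    ∃ C : ℝ, 0 < C ∧ ∀ (k : ℕ) (j : Fin k) (γ : DensityMatrix (k + 1)) (m : Freq k → ℝ),
      (∀ η, 0 ≤ m η) → (∀ η, m η ≤ sobolevWeight α η) → ∀ F : Finset (Freq (k + 1)),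
      eLpNorm (collisionSum θ j γ m F) 2 (slabMeasure k (Set.Icc 0 1)) ≤
        ENNReal.ofReal (C * Real.sqrt (mass k) * Real.sqrt (∑ ζ ∈ F,
          (sobolevWeight α ζ * ‖inversionConst (k + 1) * fourierTransform γ ζ‖) ^ 2)) := by
  obtain ⟨B₁, hB₁, h₁⟩ := exists_sum_fiber_le hα hθ
  obtain ⟨B₂, hB₂, h₂⟩ := exists_sum_fiber_swap_le hα hθ
  refine ⟨Real.sqrt (Real.exp 1 * Real.sqrt π * B₁) + Real.sqrt (Real.exp 1 * Real.sqrt π * B₂),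
    by positivity, fun k j γ m hm0 hm F => ?_⟩
  have hcoef : ∀ (ζ : Freq (k + 1)) (η : Freq k),
      ‖inversionConst (k + 1) * fourierTransform γ ζ * m η‖ ≤
        sobolevWeight α ζ * ‖inversionConst (k + 1) * fourierTransform γ ζ‖ *
          (sobolevWeight α η / sobolevWeight α ζ) := by
    intro ζ η
    have h := sobolevWeight_pos α ζ
    rw [norm_mul, Complex.norm_real, Real.norm_of_nonneg (hm0 η)]
    calc _ ≤ ‖inversionConst (k + 1) * fourierTransform γ ζ‖ * sobolevWeight α η := by
          gcongr; exact hm η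
      _ = _ := by field_simp
  refine (eLpNorm_sub_le (continuous_waveSum _ _ _ _).measurable.aestronglyMeasurable
    (continuous_waveSum _ _ _ _).measurable.aestronglyMeasurable (by norm_num)).trans ?_
  refine (add_le_add
    (eLpNorm_waveSum_le F _ _ _ hB₁.le (fun ζ _ => hcoef ζ _) (h₁ k j F))
    (eLpNorm_waveSum_le F _ _ _ hB₂.le (fun ζ _ => hcoef ζ _) (h₂ k j F))).trans (le_of_eq ?_)
  rw [← ENNReal.ofReal_add (by positivity) (by positivity)]
  congr 1
  ring

end GPHierarchy

open GPHierarchy in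
theorem proposition3p1 (α : ℝ) (hα : 1 / 2 < α) (θ : Fin 2 → ℝ) (hθ : ∀ i, 0 < θ i) :
    ∃ C : ℝ, 0 < C ∧
      ∀ (k : ℕ) (j : Fin k) (γ₀ g₀ : GPHierarchy.DensityMatrix (k + 1)),
        GPHierarchy.IsFracDeriv α γ₀ g₀ →
        ∃ H G : ℝ × GPHierarchy.Space k → ℂ,
          GPHierarchy.IsCollision (Set.Icc 0 1) j
            (fun t => ⇑(GPHierarchy.freeEvolution θ t γ₀)) H ∧
          MemLp G 2 (GPHierarchy.slabMeasure k (Set.Icc 0 1)) ∧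
          (∀ᵐ t ∂(volume.restrict (Set.Icc (0 : ℝ) 1)),
            GPHierarchy.IsFracDeriv α (fun p => H (t, p)) (fun p => G (t, p))) ∧
          eLpNorm G 2 (GPHierarchy.slabMeasure k (Set.Icc 0 1)) ≤
            ENNReal.ofReal C * eLpNorm g₀ 2 volume := by
  obtain ⟨C, hC, hbound⟩ := exists_eLpNorm_collisionSum_le hα hθ
  refine ⟨C, hC, fun k j γ₀ g₀ hγ => ?_⟩
  have hd : ∀ ζ, sobolevWeight α ζ * ‖inversionConst (k + 1) * fourierTransform γ₀ ζ‖ =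
      ‖inversionConst (k + 1) * fourierTransform g₀ ζ‖ := by
    intro ζ
    rw [hγ.fourier_eq, norm_mul, norm_mul, norm_mul, Complex.norm_real,
      Real.norm_of_nonneg (sobolevWeight_pos α ζ).le]
    ring
  have hsum := summable_norm_fourierTransform_sq hγ.memLp_deriv
  have hα0 : 0 ≤ α := by linarith
  have key : ∀ m : Freq k → ℝ, (∀ η, 0 ≤ m η) → (∀ η, m η ≤ sobolevWeight α η) →
      ∃ H : ℝ × Space k → ℂ, MemLp H 2 (slabMeasure k (Set.Icc 0 1)) ∧
        Tendsto (fun F => eLpNorm (fun q => collisionSum θ j γ₀ m F q - H q) 2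
          (slabMeasure k (Set.Icc 0 1))) atTop (𝓝 0) ∧
        eLpNorm H 2 (slabMeasure k (Set.Icc 0 1)) ≤
          ENNReal.ofReal (C * Real.sqrt (mass k) *
            Real.sqrt (∑' ζ, ‖inversionConst (k + 1) * fourierTransform g₀ ζ‖ ^ 2)) := by
    intro m hm0 hm
    have h := exists_tendsto_eLpNorm_sum (f := fun ζ => collisionSum θ j γ₀ m {ζ})
      (fun ζ => memLp_collisionSum θ j γ₀ m {ζ}) hsum (M := C * Real.sqrt (mass k))
      (by positivity) fun F => by
        simp only [sum_collisionSum_singleton]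
        have := hbound k j γ₀ m hm0 hm F
        simpa only [hd] using this
    simpa only [sum_collisionSum_singleton] using h
  obtain ⟨H, hH, hHlim, -⟩ := key 1 (fun _ => zero_le_one) (fun η => one_le_sobolevWeight hα0 η)
  obtain ⟨G, hG, hGlim, hGbound⟩ := key (sobolevWeight α) (fun η => (sobolevWeight_pos α η).le)
    (fun _ => le_rfl)
  refine ⟨H, G, ⟨hH, ?_⟩, hG, ?_, hGbound.trans ?_⟩
  · simpa only [collision_partialSum_freeEvolution θ j hγ.memLp] using hHlim
  · have hFT : ∀ᵐ t ∂(volume.restrict (Set.Icc (0 : ℝ) 1)), ∀ η : Freq k,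
        fourierTransform (fun p => G (t, p)) η =
          (sobolevWeight α η : ℂ) * fourierTransform (fun p => H (t, p)) η :=
      ae_all_iff.mpr fun η => ae_fourierTransform_eq_of_tendsto hG hH
        (fun F => continuous_collisionSum θ j γ₀ _ F) (fun F => continuous_collisionSum θ j γ₀ 1 F)
        hGlim hHlim η _ fun F t => fourierTransform_collisionSum θ j γ₀ _ F t η
    filter_upwards [ae_memLp_slice hG, ae_memLp_slice hH, hFT] with t h1 h2 h3
    exact ⟨h2, h1, h3⟩
  · have h1 : ∑' ζ, ‖inversionConst (k + 1) * fourierTransform g₀ ζ‖ ^ 2 ≤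
        (mass (k + 1))⁻¹ * (eLpNorm g₀ 2 volume).toReal ^ 2 :=
      hsum.tsum_le_of_sum_le (sum_norm_fourierTransform_sq_le hγ.memLp_deriv)
    have h2 : mass k ≤ mass (k + 1) := by
      refine pow_le_pow_right₀ ?_ (by omega)
      linarith [Real.pi_gt_three]
    have hm := mass_pos k
    have hm' := mass_pos (k + 1)
    rw [← ENNReal.ofReal_toReal hγ.memLp_deriv.2.ne, ← ENNReal.ofReal_mul hC.le, mul_assoc]
    refine ENNReal.ofReal_le_ofReal (mul_le_mul_of_nonneg_left ?_ hC.le)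
    rw [← Real.sqrt_mul hm.le]
    refine Real.sqrt_le_iff.mpr ⟨by positivity, ?_⟩
    calc _ ≤ mass (k + 1) * ((mass (k + 1))⁻¹ * (eLpNorm g₀ 2 volume).toReal ^ 2) := by gcongr
      _ = _ := by field_simp
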